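/- Let $d \in \mathbf N$, $\sigma > 0$ and $m, s \in \mathbf R$. Put $\theta_\sigma(x,\xi) = 1 + |x| + |\xi|^{1/\sigma}$ for $x,\xi \in \mathbf R^d$, and let $G^{m,\sigma}$ be the space of $a \in C^\infty(\mathbf R^{2d})$ (complex valued) such that for all multi-indices $\alpha,\beta \in \mathbf N^d$ there is a constant $C_{\alpha,\beta}$ with $$|\partial_x^\alpha \partial_\xi^\beta a(x,\xi)| \le C_{\alpha,\beta}\, \theta_\sigma(x,\xi)^{m - |\alpha| - \sigma|\beta|}, \qquad x,\xi \in \mathbf R^d .$$ Let $(u,f)$ denote the conjugate linear action of a tempered distribution $u$ on $f$. Fix $\varphi \in \mathscr S(\mathbf R^d)\setminus\{0\}$. For $u \in \mathscr S'(\mathbf R^d)$ let $$V_\varphi u(x,\xi) = (2\pi)^{-d/2}\,(u, e^{i\langle \cdot,\xi\rangle}\varphi(\cdot - x))$$ be its short-time Fourier transform, and let $M_{\sigma,s}(\mathbf R^d)$ be the space of $u \in \mathscr S'(\mathbf R^d)$ with finite norm $$\|u\|_{M_{\sigma,s}} = \Big(\iint_{\mathbf R^{2d}} |V_\varphi u(x,\xi)|^2\,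 \theta_\sigma(x,\xi)^{2s}\, dx\, d\xi\Big)^{1/2}.$$ If $a \in G^{m,\sigma}$, then the Weyl quantization $$(a^w(x,D) f, g) = (2\pi)^{-d} \iint_{\mathbf R^{2d}} a(x,\xi)\, \overline{W(g,f)(x,\xi)}\, dx\, d\xi, \qquad f,g \in \mathscr S(\mathbf R^d),$$ where $W(g,f)(x,\xi) = \int_{\mathbf R^d} g(x+\tfrac y2)\, \overline{f(x-\tfrac y2)}\, e^{-i\langle y,\xi\rangle}\, dy$, extends uniquely to a continuous linear operator $a^w(x,D)$ on $\mathscr S'(\mathbf R^d)$ (with the weak$^*$ topology), and this operator restricts to a continuous linear operator $$a^w(x,D) : M_{\sigma,s+m}(\mathbf R^d) \to M_{\sigma,s}(\mathbf R^d).$$ -/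

import Mathlib

open MeasureTheory SchwartzMap
open scoped ContDiff ComplexConjugate

noncomputable section

namespace AnisoShubin

/-- The configuration space `ℝᵈ`; phase space `T*ℝᵈ = ℝ²ᵈ` is `Rd d × Rd d`. -/
abbrev Rd (d : ℕ) : Type := EuclideanSpace ℝ (Fin d)

/-- The weight `θ_σ(x, ξ) = 1 + |x| + |ξ|^(1/σ)`. -/
def theta {d : ℕ} (σ : ℝ) (z : Rd d × Rd d) : ℝ :=
  1 + ‖z.1‖ + ‖z.2‖ ^ (1 / σ)

/-- The partial derivative `∂_{x_{i 0}} ⋯ ∂_{x_{i (j-1)}} ∂_{ξ_{l 0}} ⋯ ∂_{ξ_{l (k-1)}} a` at `z`.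
As `i` and `l` range over all index sequences of lengths `j` and `k`, and `a` is smooth, these are
the derivatives `∂_x^α ∂_ξ^β a` over all multi-indices with `|α| = j` and `|β| = k`. -/
def phasePartial {d : ℕ} (a : Rd d × Rd d → ℂ) {j k : ℕ} (i : Fin j → Fin d) (l : Fin k → Fin d)
    (z : Rd d × Rd d) : ℂ :=
  iteratedFDeriv ℝ (j + k) a z
    (Fin.append (fun n => ((EuclideanSpace.single (i n) (1 : ℝ) : Rd d), (0 : Rd d)))
      (fun n => ((0 : Rd d), (EuclideanSpace.single (l n) (1 : ℝ) : Rd d))))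

/-- The anisotropic Shubin symbols `G^{m,σ}`: smooth `a` on `ℝ²ᵈ` with
`|∂_x^α ∂_ξ^β a(x, ξ)| ≲ θ_σ(x, ξ)^(m - |α| - σ|β|)` for all `α`, `β`. -/
def IsSymbol {d : ℕ} (m σ : ℝ) (a : Rd d × Rd d → ℂ) : Prop :=
  ContDiff ℝ ∞ a ∧
    ∀ (j k : ℕ) (i : Fin j → Fin d) (l : Fin k → Fin d), ∃ C : ℝ, ∀ z : Rd d × Rd d,
      ‖phasePartial a i l z‖ ≤ C * theta σ z ^ (m - (j : ℝ) - σ * (k : ℝ))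

/-- Complex conjugation of a Schwartz function. -/
def conjS {d : ℕ} (f : 𝓢(Rd d, ℂ)) : 𝓢(Rd d, ℂ) :=
  f.postcompCLM (Complex.conjCLE : ℂ →L[ℝ] ℂ)

theorem conjS_apply {d : ℕ} (f : 𝓢(Rd d, ℂ)) (y : Rd d) : conjS f y = conj (f y) := rfl

/-- The conjugate linear action `(u, f)` of a tempered distribution on a Schwartz function,
consistent with the `L²` inner product that is conjugate linear in the second argument. -/
def sesq {d : ℕ} (u : 𝓢'(Rd d, ℂ)) (f : 𝓢(Rd d, ℂ)) : ℂ := u (conjS f)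

/-- The character `y ↦ e^{i⟨y, ξ⟩}`. -/
def character {d : ℕ} (ξ y : Rd d) : ℂ := Complex.exp (Complex.I * (inner ℝ y ξ : ℝ))

/-- The time-frequency shift `M_ξ T_x f (y) = e^{i⟨y, ξ⟩} f(y - x)`. -/
def tfShift {d : ℕ} (x ξ : Rd d) (f : 𝓢(Rd d, ℂ)) : 𝓢(Rd d, ℂ) :=
  SchwartzMap.smulLeftCLM ℂ (character ξ) (f.compSubConstCLM ℂ x)

theorem hasTemperateGrowth_character {d : ℕ} (ξ : Rd d) :
    (character ξ).HasTemperateGrowth := by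
  have h : (fun t : ℝ => Complex.exp (Complex.I * (t : ℂ))).HasTemperateGrowth := by
    refine ⟨Complex.contDiff_exp.comp (contDiff_const.mul Complex.ofRealCLM.contDiff),
      fun n => ⟨0, 1, fun t => ?_⟩⟩
    have hn : iteratedDeriv n (fun t : ℝ => Complex.exp (Complex.I * (t : ℂ)))
        = fun t : ℝ => Complex.I ^ n * Complex.exp (Complex.I * (t : ℂ)) := by
      induction n with
      | zero => simp
      | succ n ih =>
        rw [iteratedDeriv_succ, ih]
        funext t
        have h1 : HasDerivAt (fun t : ℝ => Complex.I * (t : ℂ)) (Complex.I * 1) t :=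
          (Complex.ofRealCLM.hasDerivAt (x := t)).const_mul Complex.I
        rw [((h1.cexp).const_mul (Complex.I ^ n)).deriv]
        ring
    rw [norm_iteratedFDeriv_eq_norm_iteratedDeriv, hn]
    simp [mul_comm Complex.I, Complex.norm_exp_ofReal_mul_I]
  exact h.comp (Function.hasTemperateGrowth_inner_left ξ)

theorem tfShift_apply {d : ℕ} (x ξ : Rd d) (f : 𝓢(Rd d, ℂ)) (y : Rd d) :
    tfShift x ξ f y = Complex.exp (Complex.I * (inner ℝ y ξ : ℝ)) * f (y - x) := by
  rw [tfShift, SchwartzMap.smulLeftCLM_apply_apply (hasTemperateGrowth_character ξ)]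
  rfl

/-- The short-time Fourier transform `V_φ u(x, ξ) = (2π)^(-d/2) (u, M_ξ T_x φ)`. -/
def stft {d : ℕ} (φ : 𝓢(Rd d, ℂ)) (u : 𝓢'(Rd d, ℂ)) (z : Rd d × Rd d) : ℂ :=
  (((2 * Real.pi) ^ (-(d : ℝ) / 2) : ℝ) : ℂ) * sesq u (tfShift z.1 z.2 φ)

/-- The STFT multiplied by the weight `θ_σ^s`. -/
def weightedStft {d : ℕ} (σ s : ℝ) (φ : 𝓢(Rd d, ℂ)) (u : 𝓢'(Rd d, ℂ)) (z : Rd d × Rd d) : ℂ :=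
  ((theta σ z ^ s : ℝ) : ℂ) * stft φ u z

theorem weightedStft_add {d : ℕ} (σ s : ℝ) (φ : 𝓢(Rd d, ℂ)) (u v : 𝓢'(Rd d, ℂ)) :
    weightedStft σ s φ (u + v) = weightedStft σ s φ u + weightedStft σ s φ v := by
  funext z
  have h : sesq (u + v) (tfShift z.1 z.2 φ)
      = sesq u (tfShift z.1 z.2 φ) + sesq v (tfShift z.1 z.2 φ) := rfl
  simp only [weightedStft, stft, h, Pi.add_apply]
  ring

theorem weightedStft_smul {d : ℕ} (σ s : ℝ) (φ : 𝓢(Rd d, ℂ)) (c : ℂ) (u : 𝓢'(Rd d, ℂ)) :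
    weightedStft σ s φ (c • u) = c • weightedStft σ s φ u := by
  funext z
  have h : sesq (c • u) (tfShift z.1 z.2 φ) = c * sesq u (tfShift z.1 z.2 φ) := rfl
  simp only [weightedStft, stft, h, Pi.smul_apply, smul_eq_mul]
  ring

/-- The tempered distributions with `V_φ u · θ_σ^s ∈ L²(ℝ²ᵈ)`. -/
def sobolevSubmodule {d : ℕ} (σ s : ℝ) (φ : 𝓢(Rd d, ℂ)) : Submodule ℂ 𝓢'(Rd d, ℂ) where
  carrier := {u | MemLp (weightedStft σ s φ u) 2 volume}
  add_mem' {u v} hu hv := by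
    simp only [Set.mem_ofPred_eq] at hu hv ⊢
    rw [weightedStft_add]
    exact hu.add hv
  zero_mem' := by
    have h : weightedStft σ s φ (0 : 𝓢'(Rd d, ℂ)) = 0 := by
      funext z
      have h1 : sesq (0 : 𝓢'(Rd d, ℂ)) (tfShift z.1 z.2 φ) = 0 := rfl
      simp [weightedStft, stft, h1]
    simp only [Set.mem_ofPred_eq, h]
    exact MemLp.zero
  smul_mem' c u hu := by
    simp only [Set.mem_ofPred_eq] at hu ⊢
    rw [weightedStft_smul]
    exact hu.const_smul c

/-- The anisotropic Shubin–Sobolev modulation space `M_{σ,s}(ℝᵈ)` (with window `φ`). It is a type of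
its own, since it carries the topology of its norm (below) and not the one inherited from `𝓢'`. -/
def ShubinSobolev {d : ℕ} (σ s : ℝ) (φ : 𝓢(Rd d, ℂ)) : Type := ↥(sobolevSubmodule σ s φ)

namespace ShubinSobolev

variable {d : ℕ} {σ s : ℝ} {φ : 𝓢(Rd d, ℂ)}

instance : AddCommGroup (ShubinSobolev σ s φ) :=
  inferInstanceAs (AddCommGroup ↥(sobolevSubmodule σ s φ))

instance : Module ℂ (ShubinSobolev σ s φ) :=
  inferInstanceAs (Module ℂ ↥(sobolevSubmodule σ s φ))

/-- The inclusion `M_{σ,s}(ℝᵈ) ⊆ 𝓢'(ℝᵈ)`. -/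
def incl : ShubinSobolev σ s φ →ₗ[ℂ] 𝓢'(Rd d, ℂ) := (sobolevSubmodule σ s φ).subtype

theorem memLp_weightedStft (u : ShubinSobolev σ s φ) :
    MemLp (weightedStft σ s φ (incl u)) 2 volume := u.2

/-- The map `u ↦ V_φ u · θ_σ^s` into `L²(ℝ²ᵈ)`. -/
def toL2 : ShubinSobolev σ s φ →ₗ[ℂ] Lp ℂ 2 (volume : Measure (Rd d × Rd d)) where
  toFun u := (memLp_weightedStft u).toLp
  map_add' u v := by
    rw [← MemLp.toLp_add]
    exact MemLp.toLp_congr _ _ (by rw [map_add, weightedStft_add])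
  map_smul' c u := by
    rw [RingHom.id_apply, ← MemLp.toLp_const_smul]
    exact MemLp.toLp_congr _ _ (by rw [map_smul, weightedStft_smul])

/-- `M_{σ,s}` is normed by `‖u‖ = ‖V_φ u · θ_σ^s‖_{L²}`; see `norm_eq`. -/
instance : SeminormedAddCommGroup (ShubinSobolev σ s φ) :=
  SeminormedAddCommGroup.induced _ _ (toL2 (σ := σ) (s := s) (φ := φ))

instance : NormedSpace ℂ (ShubinSobolev σ s φ) :=
  NormedSpace.induced ℂ _ _ (toL2 (σ := σ) (s := s) (φ := φ))

theorem theta_pos (σ : ℝ) (z : Rd d × Rd d) : 0 < theta σ z := by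
  unfold theta
  positivity

theorem norm_eq (u : ShubinSobolev σ s φ) :
    ‖u‖ = (∫ z : Rd d × Rd d, ‖stft φ (incl u) z‖ ^ 2 * theta σ z ^ (2 * s)) ^ (1 / 2 : ℝ) := by
  have h0 : ‖u‖ = ‖(memLp_weightedStft u).toLp‖ := rfl
  rw [h0, Lp.norm_toLp, (memLp_weightedStft u).eLpNorm_eq_integral_rpow_norm (by simp) (by simp),
    ENNReal.toReal_ofReal (by positivity)]
  have h2 : ∀ z : Rd d × Rd d, ‖weightedStft σ s φ (incl u) z‖ ^ (ENNReal.toReal 2)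
      = ‖stft φ (incl u) z‖ ^ 2 * theta σ z ^ (2 * s) := by
    intro z
    have hz := theta_pos σ z
    have h3 : theta σ z ^ (2 * s) = (theta σ z ^ s) ^ 2 := by
      rw [mul_comm, Real.rpow_mul hz.le, Real.rpow_two]
    rw [h3, weightedStft, norm_mul, Complex.norm_real, Real.norm_of_nonneg (by positivity)]
    simp only [ENNReal.toReal_ofNat, Real.rpow_two]
    ring
  simp only [h2]
  simp

end ShubinSobolev

/-- The cross-Wigner distribution
`W(g, f)(x, ξ) = ∫ g(x + y/2) conj(f(x - y/2)) e^{-i⟨y, ξ⟩} dy`. -/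
def crossWigner {d : ℕ} (g f : 𝓢(Rd d, ℂ)) (z : Rd d × Rd d) : ℂ :=
  ∫ y : Rd d, g (z.1 + (1 / 2 : ℝ) • y) * conj (f (z.1 - (1 / 2 : ℝ) • y)) *
    Complex.exp (-(Complex.I * (inner ℝ y z.2 : ℝ)))

/-- `A` is the Weyl operator `a^w(x, D)` on `𝓢'(ℝᵈ)`: a continuous linear operator that acts on
Schwartz functions by Weyl quantization,
`(A f, g) = (2π)^(-d) (a, W(g, f))` for all `f, g ∈ 𝓢(ℝᵈ)`. -/
def IsWeylOperator {d : ℕ} (a : Rd d × Rd d → ℂ) (A : 𝓢'(Rd d, ℂ) →L[ℂ] 𝓢'(Rd d, ℂ)) : Prop :=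
  ∀ f g : 𝓢(Rd d, ℂ),
    sesq (A (SchwartzMap.toTemperedDistributionCLM (Rd d) ℂ volume f)) g =
      (((2 * Real.pi) ^ (-(d : ℝ)) : ℝ) : ℂ) *
        ∫ z : Rd d × Rd d, a z * conj (crossWigner g f z)

end AnisoShubin

end

open MeasureTheory SchwartzMap
open scoped ContDiff ComplexConjugate

noncomputable section

namespace AnisoShubin

/-! ### Families of sesquilinear expressions dominated by continuous seminorms -/

/-! Write `π(z)` for the time-frequency shift by `z`. The operator is studied through its matrix
elements `(a^w π(w) f, π(z) g)`. The cross-Wigner distribution of two shifted functions is, up to a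
phase, that of the original ones translated to the midpoint `(z + w) / 2`. It decays rapidly, and
powers of `θ_σ` are polynomially moderate, so the matrix element is bounded by a multiple of `θ_σ((z
+ w) / 2) ^ m` (`dominated_weylForm`).

Commutators with multiplication and differentiation turn a factor of a coordinate of `z - w` into a
derivative of `a`, plus terms in which `f` or `g` is replaced by another Schwartz function. Every
derivative of `a` is still bounded by `θ_σ ^ m`, so iteration gives decay of any order in `|z - w|`
(`dominated_pow_mul_weylForm`). For the iteration the bounds must hold for all `f` and `g`, with
continuous seminorms; this is the role of `Dominated`.

The reconstruction formula `c f = ∫ (f, π(w) φ) π(w) φ dw` suggests defining `A` on distributions by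
`c (A u, g) = ∫ (a^w π(w) φ, g) (u, π(w) φ) dw`. This is the transpose of a continuous operator on
the Schwartz space, obtained by integrating a family of Schwartz functions
(`exists_isWeylOperator`). Uniqueness holds because a weak-* continuous functional is evaluation at
a Schwartz function, which vanishes if the functional kills all Schwartz functions.

Finally, `V_φ(A u)` arises from `V_φ u` by an integral operator whose kernel is the matrix element
with `f = g = φ`. After weighting by `θ_σ(z) ^ s` and `θ_σ(w) ^ (-(s + m))` the kernel is at most a
constant times `(1 + |z - w|) ^ (-(2d + 1))`, an integrable convolution kernel on `ℝ²ᵈ`, and Young's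
inequality gives boundedness on `L²`. -/

/-- `F g f p ≤ q₁ g * q₂ f` for continuous seminorms `q₁`, `q₂` on the Schwartz space, uniformly in
the parameter `p`. -/
def Dominated {d : ℕ} {P : Type*} (F : 𝓢(Rd d, ℂ) → 𝓢(Rd d, ℂ) → P → ℝ) : Prop :=
  ∃ q₁ q₂ : Seminorm ℂ 𝓢(Rd d, ℂ), Continuous q₁ ∧ Continuous q₂ ∧
    ∀ g f p, F g f p ≤ q₁ g * q₂ f

namespace Dominated

variable {d : ℕ} {P : Type*} {F G : 𝓢(Rd d, ℂ) → 𝓢(Rd d, ℂ) → P → ℝ}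

theorem mono (hG : Dominated G) (h : ∀ g f p, F g f p ≤ G g f p) : Dominated F := by
  obtain ⟨q₁, q₂, h₁, h₂, hq⟩ := hG
  exact ⟨q₁, q₂, h₁, h₂, fun g f p => (h g f p).trans (hq g f p)⟩

theorem add (hF : Dominated F) (hG : Dominated G) :
    Dominated fun g f p => F g f p + G g f p := by
  obtain ⟨q₁, q₂, h₁, h₂, hq⟩ := hF
  obtain ⟨r₁, r₂, k₁, k₂, hr⟩ := hG
  refine ⟨q₁ + r₁, q₂ + r₂, h₁.add k₁, h₂.add k₂, fun g f p => ?_⟩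
  have e₁ := apply_nonneg q₁ g
  have e₂ := apply_nonneg q₂ f
  have e₃ := apply_nonneg r₁ g
  have e₄ := apply_nonneg r₂ f
  have := hq g f p
  have := hr g f p
  simp only [add_apply]
  nlinarith [mul_nonneg e₁ e₄, mul_nonneg e₃ e₂]

theorem const_mul (hF : Dominated F) {c : ℝ} (hc : 0 ≤ c) :
    Dominated fun g f p => c * F g f p := by
  obtain ⟨q₁, q₂, h₁, h₂, hq⟩ := hF
  lift c to NNReal using hc
  refine ⟨c • q₁, q₂, h₁.const_smul c, h₂, fun g f p => ?_⟩
  have : (c • q₁) g = c * q₁ g := rfl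
  rw [this, mul_assoc]
  exact mul_le_mul_of_nonneg_left (hq g f p) c.2

theorem zero : Dominated fun (_ _ : 𝓢(Rd d, ℂ)) (_ : P) => (0 : ℝ) :=
  ⟨0, 0, continuous_const, continuous_const, fun g f p => by simp⟩

theorem sum {ι : Type*} (t : Finset ι) {H : ι → 𝓢(Rd d, ℂ) → 𝓢(Rd d, ℂ) → P → ℝ}
    (h : ∀ i ∈ t, Dominated (H i)) : Dominated fun g f p => ∑ i ∈ t, H i g f p := by
  classical
  induction t using Finset.induction_on with
  | empty => simpa using zero
  | insert i t hi ih =>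
    simp only [Finset.sum_insert hi]
    exact (h i (Finset.mem_insert_self i t)).add
      (ih fun j hj => h j (Finset.mem_insert_of_mem hj))

/-- Replacing the arguments by their images under continuous operators is what the commutation
identities require; a bound for one fixed pair `g`, `f` would not survive this. -/
theorem comp (hF : Dominated F) (T S : 𝓢(Rd d, ℂ) →L[ℂ] 𝓢(Rd d, ℂ)) :
    Dominated fun g f p => F (T g) (S f) p := by
  obtain ⟨q₁, q₂, h₁, h₂, hq⟩ := hF
  exact ⟨q₁.comp T.toLinearMap, q₂.comp S.toLinearMap, h₁.comp T.continuous,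
    h₂.comp S.continuous, fun g f p => hq (T g) (S f) p⟩

/-- If multiplication by `ℓ` maps each `Φ k` into a combination of `Φ (k + 1)` and of `Φ k` with
modified arguments, then domination of all `Φ k` improves to domination of `ℓ ^ N * Φ k`. -/
theorem pow_mul {Φ : ℕ → 𝓢(Rd d, ℂ) → 𝓢(Rd d, ℂ) → P → ℂ} {w ℓ : P → ℝ} (hw : ∀ p, 0 ≤ w p)
    (c₁ c₂ c₃ : ℂ) (T S : 𝓢(Rd d, ℂ) →L[ℂ] 𝓢(Rd d, ℂ))
    (hbase : ∀ k, Dominated fun g f p => w p * ‖Φ k g f p‖)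
    (hstep : ∀ k g f p, (ℓ p : ℂ) * Φ k g f p
      = c₁ * Φ (k + 1) g f p + c₂ * Φ k (T g) f p + c₃ * Φ k g (S f) p) (N k : ℕ) :
    Dominated fun g f p => |ℓ p| ^ N * (w p * ‖Φ k g f p‖) := by
  -- The bound for `N + 1` at `k` uses the bound for `N` at `k + 1`.
  induction N generalizing k with
  | zero => simpa using hbase k
  | succ N ih =>
    have h := (((ih (k + 1)).const_mul (norm_nonneg c₁)).add
      (((ih k).comp T (.id ℂ _)).const_mul (norm_nonneg c₂))).add
      (((ih k).comp (.id ℂ _) S).const_mul (norm_nonneg c₃))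
    refine h.mono fun g f p => ?_
    have e : |ℓ p| * ‖Φ k g f p‖ ≤ ‖c₁‖ * ‖Φ (k + 1) g f p‖ + ‖c₂‖ * ‖Φ k (T g) f p‖
        + ‖c₃‖ * ‖Φ k g (S f) p‖ := by
      have := congrArg norm (hstep k g f p)
      rw [norm_mul, Complex.norm_real, Real.norm_eq_abs] at this
      rw [this]
      refine (norm_add₃_le).trans ?_
      simp only [norm_mul, le_refl]
    have e' : |ℓ p| ^ (N + 1) * (w p * ‖Φ k g f p‖)
        = (|ℓ p| ^ N * w p) * (|ℓ p| * ‖Φ k g f p‖) := by ring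
    rw [e']
    refine (mul_le_mul_of_nonneg_left e (mul_nonneg (by positivity) (hw p))).trans (le_of_eq ?_)
    simp only [ContinuousLinearMap.coe_id', id_eq]
    ring

end Dominated

theorem norm_le_sum_abs {d : ℕ} (x : Rd d) : ‖x‖ ≤ ∑ j, |x j| := by
  have h : x = ∑ j, x j • (EuclideanSpace.single j (1 : ℝ) : Rd d) := by
    ext i
    simp [Pi.single_apply]
  calc ‖x‖ = ‖∑ j, x j • (EuclideanSpace.single j (1 : ℝ) : Rd d)‖ := by rw [← h]
    _ ≤ ∑ j, |x j| := by
      refine (norm_sum_le _ _).trans (le_of_eq ?_)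
      simp [norm_smul]

/-- A sum is at most the number of terms times the largest term, whose `N`-th power is among the
summands on the right. The extra summand `1` covers the empty sum with `N = 0`. -/
theorem sum_pow_le_card_pow_mul {ι : Type*} (t : Finset ι) (f : ι → ℝ) (hf : ∀ i, 0 ≤ f i) (N : ℕ) :
    (∑ i ∈ t, f i) ^ N ≤ (t.card + 1) ^ N * (1 + ∑ i ∈ t, f i ^ N) := by
  rcases t.eq_empty_or_nonempty with rfl | ht
  · rcases N with _ | N <;> simp
  obtain ⟨i₀, hi₀, hmax⟩ := t.exists_max_image f ht
  have h₁ : ∑ i ∈ t, f i ≤ (t.card + 1) * f i₀ := by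
    have := t.sum_le_card_nsmul f (f i₀) hmax
    rw [nsmul_eq_mul] at this
    nlinarith [hf i₀]
  have h₂ : f i₀ ^ N ≤ ∑ i ∈ t, f i ^ N :=
    Finset.single_le_sum (f := fun i => f i ^ N) (fun i _ => pow_nonneg (hf i) N) hi₀
  calc (∑ i ∈ t, f i) ^ N ≤ ((t.card + 1) * f i₀) ^ N :=
        pow_le_pow_left₀ (Finset.sum_nonneg fun i _ => hf i) h₁ N
    _ = (t.card + 1) ^ N * f i₀ ^ N := mul_pow _ _ _
    _ ≤ _ := by
      gcongr
      linarith

theorem exists_one_add_norm_pow_le (d N : ℕ) : ∃ C : ℝ, 0 ≤ C ∧ ∀ p : Rd d × Rd d,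
    (1 + ‖p‖) ^ N ≤ C * (1 + ∑ j, |p.1 j| ^ N + ∑ j, |p.2 j| ^ N) := by
  -- The index `none` carries the `1` in `1 + ‖p‖`; the two copies of `Fin d` carry the coordinates.
  let t : Finset (Option (Fin d ⊕ Fin d)) := Finset.univ
  refine ⟨(t.card + 1) ^ N * 2, by positivity, fun p => ?_⟩
  let f : Option (Fin d ⊕ Fin d) → ℝ := fun o => o.elim 1 (Sum.elim (fun j => |p.1 j|) fun j => |p.2 j|)
  have hf : ∀ i, 0 ≤ f i := by
    rintro (_ | _ | _) <;> simp [f]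
  have h := sum_pow_le_card_pow_mul t f hf N
  have e₁ : ∑ i ∈ t, f i = 1 + (∑ j, |p.1 j| + ∑ j, |p.2 j|) := by
    simp [t, f, Fintype.sum_option, Fintype.sum_sum_type]
  have e₂ : ∑ i ∈ t, f i ^ N = 1 + (∑ j, |p.1 j| ^ N + ∑ j, |p.2 j| ^ N) := by
    simp [t, f, Fintype.sum_option, Fintype.sum_sum_type]
  have e₃ : ‖p‖ ≤ ∑ j, |p.1 j| + ∑ j, |p.2 j| := by
    have n₁ : 0 ≤ ∑ j, |p.1 j| := Finset.sum_nonneg fun _ _ => abs_nonneg _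
    have n₂ : 0 ≤ ∑ j, |p.2 j| := Finset.sum_nonneg fun _ _ => abs_nonneg _
    rw [Prod.norm_def]
    exact max_le ((norm_le_sum_abs _).trans (by linarith)) ((norm_le_sum_abs _).trans (by linarith))
  have n₁ : 0 ≤ ∑ j, |p.1 j| ^ N := Finset.sum_nonneg fun _ _ => by positivity
  have n₂ : 0 ≤ ∑ j, |p.2 j| ^ N := Finset.sum_nonneg fun _ _ => by positivity
  calc (1 + ‖p‖) ^ N ≤ (∑ i ∈ t, f i) ^ N := by
        rw [e₁]
        gcongr
    _ ≤ _ := h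
    _ ≤ _ := by
      rw [e₂, mul_assoc]
      gcongr
      linarith

/-- Decay may be tested one coordinate at a time, which is how the commutation identities deliver
it. -/
theorem Dominated.one_add_norm_pow {d : ℕ} {P : Type*} {F : 𝓢(Rd d, ℂ) → 𝓢(Rd d, ℂ) → P → ℝ}
    (hF : ∀ g f p, 0 ≤ F g f p) (r : P → Rd d × Rd d) (N : ℕ) (h₀ : Dominated F)
    (h₁ : ∀ j, Dominated fun g f p => |(r p).1 j| ^ N * F g f p)
    (h₂ : ∀ j, Dominated fun g f p => |(r p).2 j| ^ N * F g f p) :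
    Dominated fun g f p => (1 + ‖r p‖) ^ N * F g f p := by
  obtain ⟨C, hC, h⟩ := exists_one_add_norm_pow_le d N
  refine (((h₀.add (Dominated.sum Finset.univ fun j _ => h₁ j)).add
    (Dominated.sum Finset.univ fun j _ => h₂ j)).const_mul hC).mono fun g f p => ?_
  refine (mul_le_mul_of_nonneg_right (h (r p)) (hF g f p)).trans (le_of_eq ?_)
  rw [← Finset.sum_mul, ← Finset.sum_mul]
  ring

/-! ### Multiplication and differentiation operators on the Schwartz space -/

section Operators

variable {d : ℕ}

theorem hasTemperateGrowth_inner_ofReal (v : Rd d) :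
    (fun t : Rd d => ((inner ℝ t v : ℝ) : ℂ)).HasTemperateGrowth := by
  have h := (Complex.ofRealCLM.hasTemperateGrowth).comp (Function.hasTemperateGrowth_inner_left v)
  exact h

/-- Multiplication by `t ↦ ⟨t, v⟩`. -/
def mulInner (v : Rd d) : 𝓢(Rd d, ℂ) →L[ℂ] 𝓢(Rd d, ℂ) :=
  SchwartzMap.smulLeftCLM ℂ fun t : Rd d => ((inner ℝ t v : ℝ) : ℂ)

theorem mulInner_apply (v : Rd d) (f : 𝓢(Rd d, ℂ)) (t : Rd d) :
    mulInner v f t = (inner ℝ t v : ℝ) * f t := by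
  rw [mulInner, SchwartzMap.smulLeftCLM_apply_apply (hasTemperateGrowth_inner_ofReal v), smul_eq_mul]

/-- The derivative in direction `v`. -/
def derivDir (v : Rd d) : 𝓢(Rd d, ℂ) →L[ℂ] 𝓢(Rd d, ℂ) :=
  LineDeriv.lineDerivOpCLM ℂ 𝓢(Rd d, ℂ) v

theorem derivDir_apply (v : Rd d) (f : 𝓢(Rd d, ℂ)) (t : Rd d) :
    derivDir v f t = fderiv ℝ f t v := rfl

theorem continuous_sup_schwartzSeminorm (t : Finset (ℕ × ℕ)) :
    Continuous (t.sup (schwartzSeminormFamily ℂ (Rd d) ℂ) : Seminorm ℂ 𝓢(Rd d, ℂ)) :=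
  (schwartz_withSeminorms ℂ (Rd d) ℂ).finset_sups.continuous_seminorm t

theorem exists_decay_seminorm (N : ℕ) : ∃ q : Seminorm ℂ 𝓢(Rd d, ℂ), Continuous q ∧
    ∀ f x, (1 + ‖x‖) ^ N * ‖f x‖ ≤ q f := by
  refine ⟨(2 ^ N : NNReal) • (Finset.Iic (N, 0)).sup (schwartzSeminormFamily ℂ (Rd d) ℂ), ?_, ?_⟩
  · refine Continuous.const_smul ?_ _
    exact continuous_sup_schwartzSeminorm _
  · intro f x
    have := one_add_le_sup_seminorm_apply (𝕜 := ℂ) (m := (N, 0)) (k := N) (n := 0) le_rfl le_rfl f x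
    rw [norm_iteratedFDeriv_zero] at this
    exact this

end Operators

/-! ### The cross-Wigner distribution -/

section Wigner

variable {d : ℕ}

/-- The integrand of the cross-Wigner distribution. -/
def wignerKernel (g f : 𝓢(Rd d, ℂ)) (z : Rd d × Rd d) (y : Rd d) : ℂ :=
  g (z.1 + (1 / 2 : ℝ) • y) * conj (f (z.1 - (1 / 2 : ℝ) • y)) *
    Complex.exp (-(Complex.I * (inner ℝ y z.2 : ℝ)))

theorem crossWigner_eq (g f : 𝓢(Rd d, ℂ)) (z : Rd d × Rd d) :
    crossWigner g f z = ∫ y, wignerKernel g f z y := rfl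

theorem norm_exp_neg_I_mul (t : ℝ) : ‖Complex.exp (-(Complex.I * (t : ℂ)))‖ = 1 := by
  rw [← mul_neg, mul_comm, ← Complex.ofReal_neg, Complex.norm_exp_ofReal_mul_I]

theorem norm_wignerKernel (g f : 𝓢(Rd d, ℂ)) (z : Rd d × Rd d) (y : Rd d) :
    ‖wignerKernel g f z y‖ = ‖g (z.1 + (1 / 2 : ℝ) • y)‖ * ‖f (z.1 - (1 / 2 : ℝ) • y)‖ := by
  rw [wignerKernel, norm_mul, norm_mul, norm_exp_neg_I_mul, mul_one, RCLike.norm_conj]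

/-- The variable `y` is the difference of the points at which `g` and `f` are evaluated, so decay of
`g` and `f` gives decay in `y`, uniformly in the phase-space point. -/
theorem dominated_wignerKernel (N : ℕ) :
    Dominated fun g f (p : (Rd d × Rd d) × Rd d) => (1 + ‖p.2‖) ^ N * ‖wignerKernel g f p.1 p.2‖ := by
  obtain ⟨q, hq, h⟩ := exists_decay_seminorm (d := d) N
  refine ⟨q, q, hq, hq, fun g f ⟨z, y⟩ => ?_⟩
  simp only [norm_wignerKernel]
  set u := z.1 + (1 / 2 : ℝ) • y with hu
  set v := z.1 - (1 / 2 : ℝ) • y with hv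
  have e : y = u - v := by
    rw [hu, hv]
    module
  have e₁ : 1 + ‖y‖ ≤ (1 + ‖u‖) * (1 + ‖v‖) := by
    have := norm_sub_le u v
    rw [← e] at this
    nlinarith [norm_nonneg u, norm_nonneg v, mul_nonneg (norm_nonneg u) (norm_nonneg v)]
  calc (1 + ‖y‖) ^ N * (‖g u‖ * ‖f v‖)
      ≤ ((1 + ‖u‖) * (1 + ‖v‖)) ^ N * (‖g u‖ * ‖f v‖) := by gcongr
    _ = ((1 + ‖u‖) ^ N * ‖g u‖) * ((1 + ‖v‖) ^ N * ‖f v‖) := by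
      rw [mul_pow]
      ring
    _ ≤ q g * q f := by
      gcongr
      · exact h g u
      · exact h f v

theorem continuous_wignerKernel (g f : 𝓢(Rd d, ℂ)) :
    Continuous fun p : (Rd d × Rd d) × Rd d => wignerKernel g f p.1 p.2 := by
  unfold wignerKernel
  have := g.continuous
  have := f.continuous
  fun_prop

theorem integrable_inv_one_add_norm_pow {E : Type*} [NormedAddCommGroup E] [NormedSpace ℝ E]
    [FiniteDimensional ℝ E] [MeasureSpace E] [BorelSpace E] [(volume : Measure E).IsAddHaarMeasure]
    {N : ℕ} (hN : Module.finrank ℝ E < N) : Integrable fun y : E => ((1 + ‖y‖) ^ N)⁻¹ := by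
  have h := integrable_one_add_norm (E := E) (μ := volume) (r := N) (by exact_mod_cast hN)
  refine h.congr (Filter.Eventually.of_forall fun y => ?_)
  simp only
  rw [Real.rpow_neg (by positivity), Real.rpow_natCast]

/-- The exponent `d + 1` exceeds the dimension, and the bound does not involve `z`: this is the
majorant for continuity and differentiation under the integral sign. -/
theorem exists_wignerKernel_bound (g f : 𝓢(Rd d, ℂ)) : ∃ C : ℝ, ∀ z y,
    ‖wignerKernel g f z y‖ ≤ C * ((1 + ‖y‖) ^ (d + 1))⁻¹ := by
  obtain ⟨q₁, q₂, -, -, h⟩ := dominated_wignerKernel (d := d) (d + 1)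
  refine ⟨q₁ g * q₂ f, fun z y => ?_⟩
  rw [← div_eq_mul_inv, le_div_iff₀ (by positivity), mul_comm]
  exact h g f (z, y)

theorem integrable_weight : Integrable fun y : Rd d => ((1 + ‖y‖) ^ (d + 1))⁻¹ :=
  integrable_inv_one_add_norm_pow (by simp)

theorem integrable_wignerKernel (g f : 𝓢(Rd d, ℂ)) (z : Rd d × Rd d) :
    Integrable (wignerKernel g f z) := by
  obtain ⟨C, hC⟩ := exists_wignerKernel_bound g f
  refine (integrable_weight.const_mul C).mono' ?_ (Filter.Eventually.of_forall fun y => hC z y)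
  exact ((continuous_wignerKernel g f).comp (by fun_prop : Continuous fun y => (z, y))).aestronglyMeasurable

theorem continuous_crossWigner (g f : 𝓢(Rd d, ℂ)) : Continuous (crossWigner g f) := by
  obtain ⟨C, hC⟩ := exists_wignerKernel_bound g f
  have h : Continuous fun z => ∫ y, wignerKernel g f z y := by
    refine continuous_of_dominated (bound := fun y => C * ((1 + ‖y‖) ^ (d + 1))⁻¹)
      (fun z => (integrable_wignerKernel g f z).1)
      (fun z => Filter.Eventually.of_forall fun y => hC z y) (integrable_weight.const_mul C)
      (Filter.Eventually.of_forall fun y => ?_)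
    have hg := g.continuous
    have hf := f.continuous
    unfold wignerKernel
    fun_prop
  exact h

theorem dominated_crossWigner :
    Dominated fun g f (p : Rd d × Rd d) => ‖crossWigner g f p‖ := by
  obtain ⟨q₁, q₂, h₁, h₂, h⟩ := dominated_wignerKernel (d := d) (d + 1)
  have hI : 0 ≤ ∫ y : Rd d, ((1 + ‖y‖) ^ (d + 1))⁻¹ := integral_nonneg fun y => by positivity
  refine (Dominated.const_mul ⟨q₁, q₂, h₁, h₂, fun g f _ => le_rfl⟩ hI).mono fun g f z => ?_
  rw [mul_comm, ← integral_const_mul, crossWigner_eq]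
  refine norm_integral_le_of_norm_le (integrable_weight.const_mul _)
    (Filter.Eventually.of_forall fun y => ?_)
  rw [← div_eq_mul_inv, le_div_iff₀ (by positivity), mul_comm]
  exact h g f (z, y)

theorem crossWigner_add_left (g₁ g₂ f : 𝓢(Rd d, ℂ)) (z : Rd d × Rd d) :
    crossWigner (g₁ + g₂) f z = crossWigner g₁ f z + crossWigner g₂ f z := by
  simp only [crossWigner_eq]
  rw [← integral_add (integrable_wignerKernel _ _ _) (integrable_wignerKernel _ _ _)]
  congr 1 with y
  simp only [wignerKernel, add_apply]
  ring

theorem crossWigner_add_right (g f₁ f₂ : 𝓢(Rd d, ℂ)) (z : Rd d × Rd d) :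
    crossWigner g (f₁ + f₂) z = crossWigner g f₁ z + crossWigner g f₂ z := by
  simp only [crossWigner_eq]
  rw [← integral_add (integrable_wignerKernel _ _ _) (integrable_wignerKernel _ _ _)]
  congr 1 with y
  simp only [wignerKernel, add_apply, map_add]
  ring

theorem crossWigner_smul_left (c : ℂ) (g f : 𝓢(Rd d, ℂ)) (z : Rd d × Rd d) :
    crossWigner (c • g) f z = c * crossWigner g f z := by
  simp only [crossWigner_eq]
  rw [← integral_const_mul]
  congr 1 with y
  simp only [wignerKernel, smul_apply, smul_eq_mul]
  ring

theorem crossWigner_smul_right (c : ℂ) (g f : 𝓢(Rd d, ℂ)) (z : Rd d × Rd d) :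
    crossWigner g (c • f) z = conj c * crossWigner g f z := by
  simp only [crossWigner_eq]
  rw [← integral_const_mul]
  congr 1 with y
  simp only [wignerKernel, smul_apply, smul_eq_mul, map_mul]
  ring

/-- The point `z.1` is the midpoint of the arguments of `g` and `f`. -/
theorem inner_fst_mul_crossWigner (v : Rd d) (g f : 𝓢(Rd d, ℂ)) (z : Rd d × Rd d) :
    ((inner ℝ z.1 v : ℝ) : ℂ) * crossWigner g f z
      = 1 / 2 * crossWigner (mulInner v g) f z + 1 / 2 * crossWigner g (mulInner v f) z := by
  simp only [crossWigner_eq]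
  rw [← integral_const_mul, ← integral_const_mul, ← integral_const_mul,
    ← integral_add ((integrable_wignerKernel _ _ _).const_mul _)
      ((integrable_wignerKernel _ _ _).const_mul _)]
  congr 1 with y
  simp only [wignerKernel, mulInner_apply, map_mul, Complex.conj_ofReal]
  simp only [inner_add_left, inner_sub_left, Complex.ofReal_add, Complex.ofReal_sub]
  ring

/-- Here `y` is the difference of the two arguments. A derivative in the frequency variable brings
down a factor `-i⟨y, v⟩`, so this identity keeps such derivatives within the cross-Wigner
distributions. -/
theorem inner_mul_wignerKernel (v : Rd d) (g f : 𝓢(Rd d, ℂ)) (z : Rd d × Rd d) (y : Rd d) :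
    ((inner ℝ y v : ℝ) : ℂ) * wignerKernel g f z y
      = wignerKernel (mulInner v g) f z y - wignerKernel g (mulInner v f) z y := by
  simp only [wignerKernel, mulInner_apply, map_mul, Complex.conj_ofReal]
  simp only [inner_add_left, inner_sub_left, real_inner_smul_left]
  push_cast
  ring

theorem hasDerivAt_schwartz_line (f : 𝓢(Rd d, ℂ)) (x v : Rd d) (t : ℝ) :
    HasDerivAt (fun t : ℝ => f (x + t • v)) (derivDir v f (x + t • v)) t := by
  have h : HasDerivAt (fun t : ℝ => x + t • v) v t := by
    simpa using ((hasDerivAt_id t).smul_const v).const_add x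
  exact (f.hasFDerivAt (x + t • v)).comp_hasDerivAt t h

theorem hasDerivAt_exp_line (a b t : ℝ) :
    HasDerivAt (fun t : ℝ => Complex.exp (-(Complex.I * ((a + t * b : ℝ) : ℂ))))
      (-(Complex.I * b) * Complex.exp (-(Complex.I * ((a + t * b : ℝ) : ℂ)))) t := by
  have h₁ : HasDerivAt (fun t : ℝ => a + t * b) b t := by
    simpa using ((hasDerivAt_id t).mul_const b).const_add a
  have h := ((h₁.ofReal_comp.const_mul Complex.I).fun_neg).cexp
  convert h using 1
  ring

theorem hasDerivAt_conj {f : ℝ → ℂ} {f' : ℂ} {t : ℝ} (h : HasDerivAt f f' t) :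
    HasDerivAt (fun t => conj (f t)) (conj f') t :=
  (Complex.conjCLE : ℂ →L[ℝ] ℂ).hasFDerivAt.comp_hasDerivAt t h

theorem hasDerivAt_wignerKernel (v w : Rd d) (g f : 𝓢(Rd d, ℂ)) (z : Rd d × Rd d) (y : Rd d)
    (t : ℝ) :
    HasDerivAt (fun t : ℝ => wignerKernel g f (z + t • (v, w)) y)
      (wignerKernel (derivDir v g) f (z + t • (v, w)) y
        + wignerKernel g (derivDir v f) (z + t • (v, w)) y
        - Complex.I * (wignerKernel (mulInner w g) f (z + t • (v, w)) y
          - wignerKernel g (mulInner w f) (z + t • (v, w)) y)) t := by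
  rw [← inner_mul_wignerKernel]
  have e : ∀ t : ℝ, wignerKernel g f (z + t • (v, w)) y
      = g (z.1 + (1 / 2 : ℝ) • y + t • v) * conj (f (z.1 - (1 / 2 : ℝ) • y + t • v)) *
        Complex.exp (-(Complex.I * ((inner ℝ y z.2 + t * inner ℝ y w : ℝ) : ℂ))) := by
    intro t
    simp only [wignerKernel, Prod.fst_add, Prod.snd_add, Prod.smul_fst, Prod.smul_snd,
      inner_add_right, inner_smul_right]
    rw [add_right_comm, sub_add_eq_add_sub]
  have h := ((hasDerivAt_schwartz_line g (z.1 + (1 / 2 : ℝ) • y) v t).mul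
    (hasDerivAt_conj (hasDerivAt_schwartz_line f (z.1 - (1 / 2 : ℝ) • y) v t))).mul
    (hasDerivAt_exp_line (inner ℝ y z.2) (inner ℝ y w) t)
  refine (h.congr_of_eventuallyEq (Filter.Eventually.of_forall e)).congr_deriv ?_
  simp only [wignerKernel, Prod.fst_add, Prod.snd_add, Prod.smul_fst, Prod.smul_snd,
      inner_add_right, inner_smul_right, Pi.mul_apply]
  rw [add_right_comm z.1 ((1 / 2 : ℝ) • y), sub_add_eq_add_sub]
  push_cast
  ring

theorem hasLineDerivAt_crossWigner (v w : Rd d) (g f : 𝓢(Rd d, ℂ)) (z : Rd d × Rd d) :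
    HasLineDerivAt ℝ (crossWigner g f)
      (crossWigner (derivDir v g) f z + crossWigner g (derivDir v f) z
        - Complex.I * (crossWigner (mulInner w g) f z - crossWigner g (mulInner w f) z)) z (v, w) := by
  obtain ⟨C₁, h₁⟩ := exists_wignerKernel_bound (derivDir v g) f
  obtain ⟨C₂, h₂⟩ := exists_wignerKernel_bound g (derivDir v f)
  obtain ⟨C₃, h₃⟩ := exists_wignerKernel_bound (mulInner w g) f
  obtain ⟨C₄, h₄⟩ := exists_wignerKernel_bound g (mulInner w f)
  have key := (hasDerivAt_integral_of_dominated_loc_of_deriv_le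
    (F := fun (t : ℝ) y => wignerKernel g f (z + t • (v, w)) y)
    (F' := fun (t : ℝ) y => wignerKernel (derivDir v g) f (z + t • (v, w)) y
        + wignerKernel g (derivDir v f) (z + t • (v, w)) y
        - Complex.I * (wignerKernel (mulInner w g) f (z + t • (v, w)) y
          - wignerKernel g (mulInner w f) (z + t • (v, w)) y))
    -- One constant for each of the four terms of the derivative; none depends on `t`, as the kernel
    -- bounds are uniform in the phase-space point.
    (bound := fun y => (C₁ + C₂ + (C₃ + C₄)) * ((1 + ‖y‖) ^ (d + 1))⁻¹)
    (x₀ := (0 : ℝ)) (μ := volume) (s := Set.univ) Filter.univ_mem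
    (Filter.Eventually.of_forall fun t => (integrable_wignerKernel g f _).1)
    (integrable_wignerKernel g f _)
    (((integrable_wignerKernel _ _ _).1.add (integrable_wignerKernel _ _ _).1).sub
      (((integrable_wignerKernel _ _ _).1.sub (integrable_wignerKernel _ _ _).1).const_mul _))
    (Filter.Eventually.of_forall fun y t _ => ?_)
    (integrable_weight.const_mul _)
    (Filter.Eventually.of_forall fun y t _ => hasDerivAt_wignerKernel v w g f z y t)).2
  · refine HasDerivAt.congr_deriv (f := fun t : ℝ => crossWigner g f (z + t • (v, w))) key ?_
    simp only [zero_smul, add_zero, crossWigner_eq]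
    have i₁ := integrable_wignerKernel (derivDir v g) f z
    have i₂ := integrable_wignerKernel g (derivDir v f) z
    have i₃ := integrable_wignerKernel (mulInner w g) f z
    have i₄ := integrable_wignerKernel g (mulInner w f) z
    have i₅ : Integrable fun y => wignerKernel (mulInner w g) f z y - wignerKernel g (mulInner w f) z y :=
      i₃.sub i₄
    rw [integral_sub (i₁.fun_add i₂) (i₅.const_mul _), integral_const_mul,
      integral_sub i₃ i₄, integral_add i₁ i₂]
  · refine (norm_sub_le _ _).trans ?_
    rw [norm_mul, Complex.norm_I, one_mul]
    refine (add_le_add (norm_add_le _ _) (norm_sub_le _ _)).trans ?_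
    have := h₁ (z + t • (v, w)) y
    have := h₂ (z + t • (v, w)) y
    have := h₃ (z + t • (v, w)) y
    have := h₄ (z + t • (v, w)) y
    nlinarith

/-- Integration by parts in `y`: `⟨ξ, v⟩ e^{-i⟨y, ξ⟩}` is `i` times the derivative of the
exponential in direction `v`, and the factors `±1/2` come from the arguments `x ± y/2`. -/
theorem inner_snd_mul_crossWigner (v : Rd d) (g f : 𝓢(Rd d, ℂ)) (z : Rd d × Rd d) :
    ((inner ℝ z.2 v : ℝ) : ℂ) * crossWigner g f z
      = -Complex.I / 2 * crossWigner (derivDir v g) f z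
        + Complex.I / 2 * crossWigner g (derivDir v f) z := by
  let h : Rd d → ℂ := fun y => g (z.1 + (1 / 2 : ℝ) • y) * conj (f (z.1 - (1 / 2 : ℝ) • y))
  let h' : Rd d → ℂ := fun y =>
    1 / 2 * (derivDir v g (z.1 + (1 / 2 : ℝ) • y) * conj (f (z.1 - (1 / 2 : ℝ) • y)))
      - 1 / 2 * (g (z.1 + (1 / 2 : ℝ) • y) * conj (derivDir v f (z.1 - (1 / 2 : ℝ) • y)))
  let e : Rd d → ℂ := fun y => Complex.exp (-(Complex.I * (inner ℝ y z.2 : ℝ)))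
  have dh : ∀ y, HasLineDerivAt ℝ h (h' y) y v := by
    intro y
    have k₁ : HasDerivAt (fun t : ℝ => g (z.1 + (1 / 2 : ℝ) • (y + t • v)))
        (1 / 2 * derivDir v g (z.1 + (1 / 2 : ℝ) • y)) 0 := by
      have := hasDerivAt_schwartz_line g (z.1 + (1 / 2 : ℝ) • y) ((1 / 2 : ℝ) • v) 0
      simp only [zero_smul, add_zero, derivDir_apply, map_smul] at this
      convert this using 1
      · ext t
        congr 1
        module
      · rw [derivDir_apply]
        simp
    have k₂ : HasDerivAt (fun t : ℝ => f (z.1 - (1 / 2 : ℝ) • (y + t • v)))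
        (-(1 / 2 * derivDir v f (z.1 - (1 / 2 : ℝ) • y))) 0 := by
      have := hasDerivAt_schwartz_line f (z.1 - (1 / 2 : ℝ) • y) (-(1 / 2 : ℝ) • v) 0
      simp only [zero_smul, add_zero, derivDir_apply, map_smul] at this
      convert this using 1
      · ext t
        congr 1
        module
      · rw [derivDir_apply]
        simp
    have k := k₁.mul (hasDerivAt_conj k₂)
    refine HasDerivAt.congr_deriv (f := fun t : ℝ => h (y + t • v)) k ?_
    simp only [h', zero_smul, add_zero, map_neg, map_mul, map_div₀, map_one, Complex.conj_ofNat]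
    ring
  have de : ∀ y, HasLineDerivAt ℝ e (-(Complex.I * (inner ℝ z.2 v : ℝ)) * e y) y v := by
    intro y
    have k := hasDerivAt_exp_line (inner ℝ y z.2) (inner ℝ v z.2) 0
    rw [real_inner_comm v z.2] 
    have : (fun t : ℝ => e (y + t • v)) = fun t : ℝ =>
        Complex.exp (-(Complex.I * ((inner ℝ y z.2 + t * inner ℝ v z.2 : ℝ) : ℂ))) := by
      ext t
      simp only [e, inner_add_left, real_inner_smul_left]
    unfold HasLineDerivAt
    rw [this]
    simpa [e] using k
  have i₁ := integrable_wignerKernel (derivDir v g) f z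
  have i₂ := integrable_wignerKernel g (derivDir v f) z
  have i₃ := integrable_wignerKernel g f z
  have e₁ : ∀ y, h' y * e y = 1 / 2 * wignerKernel (derivDir v g) f z y
      - 1 / 2 * wignerKernel g (derivDir v f) z y := by
    intro y
    simp only [h', e, wignerKernel]
    ring
  have e₂ : ∀ y, h y * (-(Complex.I * (inner ℝ z.2 v : ℝ)) * e y)
      = -(Complex.I * (inner ℝ z.2 v : ℝ)) * wignerKernel g f z y := by
    intro y
    simp only [h, e, wignerKernel]
    ring
  have ibp := integral_bilinear_hasLineDerivAt_right_eq_neg_left_of_integrable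
    (B := ContinuousLinearMap.mul ℝ ℂ) (f := h) (f' := h') (g := e)
    (g' := fun y => -(Complex.I * (inner ℝ z.2 v : ℝ)) * e y) (v := v) (μ := volume)
    (by
      simp only [ContinuousLinearMap.mul_apply', e₁]
      exact (i₁.const_mul _).sub (i₂.const_mul _))
    (by
      simp only [ContinuousLinearMap.mul_apply', e₂]
      exact i₃.const_mul _)
    (by
      simp only [ContinuousLinearMap.mul_apply']
      exact i₃)
    (fun y _ => dh y) (fun y _ => de y)
  simp only [ContinuousLinearMap.mul_apply', e₁, e₂] at ibp
  rw [integral_const_mul, integral_sub (i₁.const_mul _) (i₂.const_mul _), integral_const_mul,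
    integral_const_mul] at ibp
  simp only [← crossWigner_eq] at ibp
  linear_combination Complex.I * ibp + ((inner ℝ z.2 v : ℝ) : ℂ) * crossWigner g f z * Complex.I_sq

theorem inner_single (x : Rd d) (j : Fin d) :
    inner ℝ x (EuclideanSpace.single j (1 : ℝ) : Rd d) = x j := by
  simp [EuclideanSpace.inner_single_right]

/-- Rapid decay of the cross-Wigner distribution, with continuous dependence on both arguments. -/
theorem dominated_pow_mul_crossWigner (N : ℕ) :
    Dominated fun g f (p : Rd d × Rd d) => (1 + ‖p‖) ^ N * ‖crossWigner g f p‖ := by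
  have hbase : ∀ _ : ℕ, Dominated fun g f (p : Rd d × Rd d) => 1 * ‖crossWigner g f p‖ := fun _ => by
    simpa using dominated_crossWigner (d := d)
  refine Dominated.one_add_norm_pow (fun _ _ _ => norm_nonneg _) id N dominated_crossWigner
    (fun j => ?_) fun j => ?_
  -- The family is constant in `k` and the coefficient of `Φ (k + 1)` is `0`: multiplication by a
  -- phase-space coordinate only changes the arguments `g` and `f`.
  · have := Dominated.pow_mul (Φ := fun _ => crossWigner (d := d)) (w := fun _ => 1)
      (ℓ := fun p => p.1 j) (fun _ => zero_le_one) 0 (1 / 2) (1 / 2)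
      (mulInner (EuclideanSpace.single j 1)) (mulInner (EuclideanSpace.single j 1)) hbase
      (fun _ g f p => by
        have := inner_fst_mul_crossWigner (EuclideanSpace.single j (1 : ℝ)) g f p
        rw [inner_single] at this
        rw [this]
        ring) N 0
    simpa using this
  · have := Dominated.pow_mul (Φ := fun _ => crossWigner (d := d)) (w := fun _ => 1)
      (ℓ := fun p => p.2 j) (fun _ => zero_le_one) 0 (-Complex.I / 2) (Complex.I / 2)
      (derivDir (EuclideanSpace.single j 1)) (derivDir (EuclideanSpace.single j 1)) hbase
      (fun _ g f p => by
        have := inner_snd_mul_crossWigner (EuclideanSpace.single j (1 : ℝ)) g f p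
        rw [inner_single] at this
        rw [this]
        ring) N 0
    simpa using this

end Wigner

/-! ### Integrals of continuous families of Schwartz functions -/

section SchwartzIntegral

variable {X : Type*} [NormedAddCommGroup X] [NormedSpace ℝ X]

/-- A linear functional dominated by finitely many seminorms `‖J i ·‖` commutes with an integral as
soon as all `J i` do. -/
theorem apply_eq_integral_of_norm_le_sum {Z V ι : Type*} [MeasurableSpace Z] {μ : Measure Z}
    [AddCommGroup V] [Module ℂ V] [Fintype ι] {E : ι → Type*} [∀ i, NormedAddCommGroup (E i)]
    [∀ i, NormedSpace ℂ (E i)] [∀ i, CompleteSpace (E i)] (J : (i : ι) → V →ₗ[ℂ] E i)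
    (u : V →ₗ[ℂ] ℂ) {C : ℝ} (hC : 0 ≤ C) (hu : ∀ f, ‖u f‖ ≤ C * ∑ i, ‖J i f‖) {Φ : Z → V} {h : V}
    (hΦi : ∀ i, Integrable (fun z => J i (Φ z)) μ) (hh : ∀ i, J i h = ∫ z, J i (Φ z) ∂μ) :
    u h = ∫ z, u (Φ z) ∂μ := by
  let K : V →ₗ[ℂ] ((i : ι) → E i) := LinearMap.pi J
  have hb : ∀ f, ‖u f‖ ≤ C * Fintype.card ι * ‖K f‖ := by
    intro f
    refine (hu f).trans ?_
    rw [mul_assoc]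
    gcongr
    have := Finset.sum_le_card_nsmul Finset.univ (fun i => ‖J i f‖) ‖K f‖
      fun i _ => norm_le_pi_norm (K f) i
    simpa using this
  -- The functional `u` vanishes on the kernel of `K`, so it factors as `ℓ ∘ K`. The bound `hb`
  -- makes `ℓ` continuous on the range of `K`, and Hahn–Banach extends it to the product of the
  -- Banach spaces `E i`, where continuous functionals commute with the Bochner integral.
  have hker : (u : Module.Dual ℂ V) ∈ K.ker.dualAnnihilator := by
    rw [Submodule.mem_dualAnnihilator]
    intro f hf
    have := hb f
    rw [LinearMap.mem_ker.1 hf, norm_zero, mul_zero] at this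
    exact norm_le_zero_iff.1 this
  rw [← LinearMap.range_dualMap_eq_dualAnnihilator_ker] at hker
  obtain ⟨ℓ, hℓ⟩ := hker
  have hℓ' : ∀ f, ℓ (K f) = u f := fun f => LinearMap.congr_fun hℓ f
  let ℓ₀ : K.range →L[ℂ] ℂ := (ℓ.domRestrict K.range).mkContinuous (C * Fintype.card ι) (by
    rintro ⟨_, f, rfl⟩
    change ‖ℓ (K f)‖ ≤ _ * ‖K f‖
    rw [hℓ']
    exact hb f)
  obtain ⟨L, hL, -⟩ := exists_extension_norm_eq K.range ℓ₀
  have hLK : ∀ f, L (K f) = u f := by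
    intro f
    have := hL ⟨K f, f, rfl⟩
    change L (K f) = ℓ (K f) at this
    rwa [hℓ'] at this
  have hKint : Integrable (fun z => K (Φ z)) μ := Integrable.of_eval hΦi
  have key : K h = ∫ z, K (Φ z) ∂μ := by
    ext i
    exact (hh i).trans (eval_integral hΦi i).symm
  rw [← hLK, key, ← L.integral_comp_comm hKint]
  simp only [hLK]

/-- Bounded continuous functions with values in the `n`-linear forms on `X`. -/
abbrev BoundedForms (X : Type*) [NormedAddCommGroup X] [NormedSpace ℝ X] (n : ℕ) : Type _ :=
  BoundedContinuousFunction (X) (ContinuousMultilinearMap ℝ (fun _ : Fin n => X) ℂ)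

instance (X : Type*) [NormedAddCommGroup X] [NormedSpace ℝ X] (n : ℕ) :
    NormedAddCommGroup (BoundedForms X n) := inferInstance

instance (X : Type*) [NormedAddCommGroup X] [NormedSpace ℝ X] (n : ℕ) :
    NormedSpace ℂ (BoundedForms X n) := inferInstance

instance (X : Type*) [NormedAddCommGroup X] [NormedSpace ℝ X] (n : ℕ) :
    NormedSpace ℝ (BoundedForms X n) := inferInstance

/-- The weighted derivative `y ↦ ‖y‖ ^ k • D^n f y` as a bounded continuous function. -/
def weightedDeriv (k n : ℕ) : 𝓢(X, ℂ) →ₗ[ℂ] BoundedForms X n where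
  toFun f := BoundedContinuousFunction.ofNormedAddCommGroup
    (fun y => (‖y‖ ^ k) • iteratedFDeriv ℝ n f y)
    ((continuous_norm.pow k).smul ((f.smooth ⊤).continuous_iteratedFDeriv (mod_cast le_top)))
    (SchwartzMap.seminorm ℂ k n f) fun y => by
      rw [norm_smul, norm_pow, norm_norm]
      exact SchwartzMap.le_seminorm ℂ k n f y
  map_add' f g := by
    ext1 y
    change (‖y‖ ^ k) • iteratedFDeriv ℝ n (f + g : X → ℂ) y = _
    rw [iteratedFDeriv_add_apply ((f.smooth n).contDiffAt) ((g.smooth n).contDiffAt), smul_add]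
    rfl
  map_smul' c f := by
    ext1 y
    change (‖y‖ ^ k) • iteratedFDeriv ℝ n (c • f : X → ℂ) y = _
    rw [iteratedFDeriv_const_smul_apply ((f.smooth n).contDiffAt), smul_comm]
    rfl

theorem weightedDeriv_apply (k n : ℕ) (f : 𝓢(X, ℂ)) (y : X) :
    weightedDeriv k n f y = (‖y‖ ^ k) • iteratedFDeriv ℝ n f y := rfl

/-- Each Schwartz seminorm is the norm of a linear map into a Banach space, so Bochner integration
applies to each seminorm separately. -/
theorem norm_weightedDeriv (k n : ℕ) (f : 𝓢(X, ℂ)) :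
    ‖weightedDeriv k n f‖ = SchwartzMap.seminorm ℂ k n f := by
  apply le_antisymm
  · refine (BoundedContinuousFunction.norm_le (apply_nonneg _ _)).2 fun y => ?_
    rw [weightedDeriv_apply, norm_smul, norm_pow, norm_norm]
    exact SchwartzMap.le_seminorm ℂ k n f y
  · refine SchwartzMap.seminorm_le_bound ℂ k n f
      (norm_nonneg (weightedDeriv k n f : BoundedForms X n)) fun y => ?_
    have := (weightedDeriv k n f).norm_coe_le_norm y
    rwa [weightedDeriv_apply, norm_smul, norm_pow, norm_norm] at this

theorem continuous_weightedDeriv (k n : ℕ) : Continuous (weightedDeriv (X := X) k n) := by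
  refine continuous_of_continuousAt_zero (weightedDeriv (X := X) k n) ?_
  rw [ContinuousAt, map_zero, tendsto_zero_iff_norm_tendsto_zero]
  simp only [norm_weightedDeriv]
  have := ((schwartz_withSeminorms ℂ (X) ℂ).continuous_seminorm (k, n)).tendsto 0
  simpa using this

theorem continuous_iteratedFDeriv_apply (n : ℕ) (y : X) :
    Continuous fun f : 𝓢(X, ℂ) => iteratedFDeriv ℝ n f y := by
  have h := (BoundedContinuousFunction.evalCLM ℝ y).continuous.comp
    (continuous_weightedDeriv (X := X) 0 n)
  refine h.congr fun f => ?_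
  simp [weightedDeriv_apply]

theorem integral_curryLeft {Z : Type*} [MeasurableSpace Z] {μ : Measure Z} {m : ℕ}
    {F : Z → ContinuousMultilinearMap ℝ (fun _ : Fin (m + 1) => X) ℂ} :
    ∫ z, (F z).curryLeft ∂μ = (∫ z, F z ∂μ).curryLeft :=
  (continuousMultilinearCurryLeftEquiv ℝ (fun _ : Fin (m + 1) => X)
    ℂ).toContinuousLinearEquiv.integral_comp_comm
    (E := ContinuousMultilinearMap ℝ (fun _ : Fin (m + 1) => X) ℂ)
    (F := X →L[ℝ] ContinuousMultilinearMap ℝ (fun _ : Fin m => X) ℂ) (𝕜 := ℝ) F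

variable {Z : Type*} [TopologicalSpace Z] [SecondCountableTopology Z] [MeasurableSpace Z]
  [BorelSpace Z] {μ : Measure Z} {Φ : Z → 𝓢(X, ℂ)}

theorem integrable_iteratedFDeriv_family (hΦ : Continuous Φ)
    (hΦi : ∀ k n, Integrable (fun z => SchwartzMap.seminorm ℂ k n (Φ z)) μ) (n : ℕ) (y : X) :
    Integrable (fun z => iteratedFDeriv ℝ n (Φ z) y) μ :=
  (hΦi 0 n).mono' ((continuous_iteratedFDeriv_apply n y).comp hΦ).aestronglyMeasurable
    (Filter.Eventually.of_forall fun z => SchwartzMap.norm_iteratedFDeriv_le_seminorm ℂ (Φ z) n y)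

/-- Differentiation under the integral sign at every order: the derivative of order `m + 1` is
dominated, uniformly in `y`, by the integrable seminorm of index `(0, m + 1)`. -/
theorem hasFTaylorSeriesUpTo_integral_family (hΦ : Continuous Φ)
    (hΦi : ∀ k n, Integrable (fun z => SchwartzMap.seminorm ℂ k n (Φ z)) μ) :
    HasFTaylorSeriesUpTo ∞ (fun y => ∫ z, Φ z y ∂μ)
      (fun y n => ∫ z, iteratedFDeriv ℝ n (Φ z) y ∂μ) := by
  have hd : ∀ (m : ℕ) (y : X), HasFDerivAt (fun y => ∫ z, iteratedFDeriv ℝ m (Φ z) y ∂μ)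
      ((∫ z, iteratedFDeriv ℝ (m + 1) (Φ z) y ∂μ).curryLeft) y := by
    intro m y
    have key := hasFDerivAt_integral_of_dominated_of_fderiv_le (𝕜 := ℝ) (μ := μ)
      (F := fun y z => iteratedFDeriv ℝ m (Φ z) y)
      (F' := fun y z => (iteratedFDeriv ℝ (m + 1) (Φ z) y).curryLeft)
      (bound := fun z => SchwartzMap.seminorm ℂ 0 (m + 1) (Φ z)) (x₀ := y) (s := Set.univ)
      Filter.univ_mem
      (Filter.Eventually.of_forall fun y => (integrable_iteratedFDeriv_family hΦ hΦi m y).1)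
      (integrable_iteratedFDeriv_family hΦ hΦi m y)
      ((continuousMultilinearCurryLeftEquiv ℝ (fun _ : Fin (m + 1) => X) ℂ).continuous.comp_aestronglyMeasurable
        (integrable_iteratedFDeriv_family hΦ hΦi (m + 1) y).1)
      (Filter.Eventually.of_forall fun z x _ => by
        rw [ContinuousMultilinearMap.curryLeft_norm]
        exact SchwartzMap.norm_iteratedFDeriv_le_seminorm ℂ (Φ z) (m + 1) x)
      (hΦi 0 (m + 1))
      (Filter.Eventually.of_forall fun z x _ => by
        have := ((Φ z).smooth ⊤).ftaylorSeries (𝕜 := ℝ)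
        exact this.fderiv m (mod_cast WithTop.coe_lt_top m) x)
    refine key.congr_fderiv ?_
    exact integral_curryLeft
  refine ⟨fun y => ?_, fun m _ y => hd m y, fun m _ => ?_⟩
  · have := (ContinuousMultilinearMap.apply ℝ (fun _ : Fin 0 => X) ℂ 0).integral_comp_comm
      (integrable_iteratedFDeriv_family hΦ hΦi 0 y)
    exact this.symm
  · exact continuous_iff_continuousAt.2 fun y => (hd m y).continuousAt

theorem norm_pow_mul_iteratedFDeriv_integral_family_le (hΦ : Continuous Φ)
    (hΦi : ∀ k n, Integrable (fun z => SchwartzMap.seminorm ℂ k n (Φ z)) μ) (k n : ℕ) (y : X) :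
    ‖y‖ ^ k * ‖iteratedFDeriv ℝ n (fun y => ∫ z, Φ z y ∂μ) y‖
      ≤ ∫ z, SchwartzMap.seminorm ℂ k n (Φ z) ∂μ := by
  rw [← (hasFTaylorSeriesUpTo_integral_family hΦ hΦi).eq_iteratedFDeriv (mod_cast le_top) y]
  calc ‖y‖ ^ k * ‖∫ z, iteratedFDeriv ℝ n (Φ z) y ∂μ‖
      = ‖∫ z, (‖y‖ ^ k) • iteratedFDeriv ℝ n (Φ z) y ∂μ‖ := by
        rw [integral_smul, norm_smul, norm_pow, norm_norm]
    _ ≤ _ := norm_integral_le_of_norm_le (hΦi k n) (Filter.Eventually.of_forall fun z => by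
        rw [norm_smul, norm_pow, norm_norm]
        exact SchwartzMap.le_seminorm ℂ k n (Φ z) y)

/-- The integral of a continuous family of Schwartz functions with integrable seminorms. -/
def schwartzIntegral (hΦ : Continuous Φ)
    (hΦi : ∀ k n, Integrable (fun z => SchwartzMap.seminorm ℂ k n (Φ z)) μ) : 𝓢(X, ℂ) where
  toFun y := ∫ z, Φ z y ∂μ
  smooth' := (hasFTaylorSeriesUpTo_integral_family hΦ hΦi).contDiff
  decay' k n := ⟨_, norm_pow_mul_iteratedFDeriv_integral_family_le hΦ hΦi k n⟩

theorem schwartzIntegral_apply (hΦ : Continuous Φ)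
    (hΦi : ∀ k n, Integrable (fun z => SchwartzMap.seminorm ℂ k n (Φ z)) μ) (y : X) :
    schwartzIntegral hΦ hΦi y = ∫ z, Φ z y ∂μ := rfl

theorem seminorm_schwartzIntegral_le (hΦ : Continuous Φ)
    (hΦi : ∀ k n, Integrable (fun z => SchwartzMap.seminorm ℂ k n (Φ z)) μ) (k n : ℕ) :
    SchwartzMap.seminorm ℂ k n (schwartzIntegral hΦ hΦi)
      ≤ ∫ z, SchwartzMap.seminorm ℂ k n (Φ z) ∂μ :=
  SchwartzMap.seminorm_le_bound ℂ k n _ (integral_nonneg fun _ => apply_nonneg _ _)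
    (norm_pow_mul_iteratedFDeriv_integral_family_le hΦ hΦi k n)

theorem integrable_weightedDeriv_family (hΦ : Continuous Φ)
    (hΦi : ∀ k n, Integrable (fun z => SchwartzMap.seminorm ℂ k n (Φ z)) μ) (k n : ℕ) :
    Integrable (fun z => weightedDeriv k n (Φ z)) μ :=
  (hΦi k n).mono' ((continuous_weightedDeriv k n).comp hΦ).aestronglyMeasurable
    (Filter.Eventually.of_forall fun z => le_of_eq (norm_weightedDeriv k n (Φ z)))

theorem weightedDeriv_schwartzIntegral (hΦ : Continuous Φ)
    (hΦi : ∀ k n, Integrable (fun z => SchwartzMap.seminorm ℂ k n (Φ z)) μ) (k n : ℕ) :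
    weightedDeriv k n (schwartzIntegral hΦ hΦi) = ∫ z, weightedDeriv k n (Φ z) ∂μ := by
  ext1 y
  have h₁ := (BoundedContinuousFunction.evalCLM ℝ y).integral_comp_comm
    (E := BoundedForms X n) (Fₗ := ContinuousMultilinearMap ℝ (fun _ : Fin n => X) ℂ)
    (integrable_weightedDeriv_family hΦ hΦi k n)
  refine Eq.trans ?_ h₁
  change (‖y‖ ^ k) • iteratedFDeriv ℝ n (fun y => ∫ z, Φ z y ∂μ) y
    = ∫ z, (‖y‖ ^ k) • iteratedFDeriv ℝ n (Φ z) y ∂μ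
  rw [integral_smul,
    ← (hasFTaylorSeriesUpTo_integral_family hΦ hΦi).eq_iteratedFDeriv (mod_cast le_top) y]

/-- A continuous functional is bounded by finitely many Schwartz seminorms, that is, by norms of the
maps `weightedDeriv`, and these commute with the integral. -/
theorem apply_schwartzIntegral (hΦ : Continuous Φ)
    (hΦi : ∀ k n, Integrable (fun z => SchwartzMap.seminorm ℂ k n (Φ z)) μ)
    (u : 𝓢(X, ℂ) →L[ℂ] ℂ) : u (schwartzIntegral hΦ hΦi) = ∫ z, u (Φ z) ∂μ := by
  obtain ⟨t, C, -, hC⟩ := Seminorm.bound_of_continuous (schwartz_withSeminorms ℂ (X) ℂ)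
    ((normSeminorm ℂ ℂ).comp u.toLinearMap) (by
      change Continuous fun f => ‖u f‖
      exact u.continuous.norm)
  have hb : ∀ f, ‖u f‖ ≤ C * ∑ i : t, ‖weightedDeriv i.1.1 i.1.2 f‖ := by
    intro f
    simp only [norm_weightedDeriv]
    refine (hC f).trans ?_
    change C * (t.sup (schwartzSeminormFamily ℂ (X) ℂ)) f ≤ _
    refine mul_le_mul_of_nonneg_left ?_ C.2
    refine Seminorm.finset_sup_apply_le (Finset.sum_nonneg fun _ _ => apply_nonneg _ _) fun i hi => ?_
    rw [Finset.sum_coe_sort t fun i => SchwartzMap.seminorm ℂ i.1 i.2 f]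
    exact Finset.single_le_sum (f := fun i : ℕ × ℕ => SchwartzMap.seminorm ℂ i.1 i.2 f)
      (fun _ _ => apply_nonneg _ _) hi
  exact apply_eq_integral_of_norm_le_sum (ι := t) (E := fun i => BoundedForms X i.1.2)
    (fun i => weightedDeriv i.1.1 i.1.2) u.toLinearMap C.2 hb
    (fun i => integrable_weightedDeriv_family hΦ hΦi i.1.1 i.1.2)
    fun i => weightedDeriv_schwartzIntegral hΦ hΦi i.1.1 i.1.2

end SchwartzIntegral

/-! ### Time-frequency shifts on the Schwartz space -/

section Shifts

variable {d : ℕ}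

theorem one_add_norm_le_mul {E : Type*} [SeminormedAddCommGroup E] (x y : E) :
    1 + ‖y‖ ≤ (1 + ‖x‖) * (1 + ‖y - x‖) := by
  have := norm_add_le x (y - x)
  rw [add_sub_cancel] at this
  nlinarith [norm_nonneg x, norm_nonneg (y - x), mul_nonneg (norm_nonneg x) (norm_nonneg (y - x))]

/-- Translations act on the Schwartz space with polynomially bounded seminorms. -/
theorem exists_seminorm_translate_le (p : Seminorm ℂ 𝓢(Rd d, ℂ)) (hp : Continuous p) :
    ∃ (N : ℕ) (q : Seminorm ℂ 𝓢(Rd d, ℂ)), Continuous q ∧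
      ∀ x f, p (f.compSubConstCLM ℂ x) ≤ (1 + ‖x‖) ^ N * q f := by
  obtain ⟨t, C, -, hC⟩ := Seminorm.bound_of_continuous (schwartz_withSeminorms ℂ (Rd d) ℂ) p hp
  -- The componentwise supremum bounds all the seminorm indices in `t` at once.
  let m : ℕ × ℕ := t.sup id
  refine ⟨m.1, (C * 2 ^ m.1) • (Finset.Iic m).sup (schwartzSeminormFamily ℂ (Rd d) ℂ),
    (continuous_sup_schwartzSeminorm _).const_smul _, fun x f => (hC _).trans ?_⟩
  change C * (t.sup (schwartzSeminormFamily ℂ (Rd d) ℂ)) _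
    ≤ _ * ((C * 2 ^ m.1) * ((Finset.Iic m).sup (schwartzSeminormFamily ℂ (Rd d) ℂ)) f)
  have h : (t.sup (schwartzSeminormFamily ℂ (Rd d) ℂ)) (f.compSubConstCLM ℂ x) ≤ (1 + ‖x‖) ^ m.1
      * (2 ^ m.1 * ((Finset.Iic m).sup (schwartzSeminormFamily ℂ (Rd d) ℂ)) f) := by
    refine Seminorm.finset_sup_apply_le
      (mul_nonneg (by positivity) (mul_nonneg (by positivity) (apply_nonneg _ _))) fun i hi => ?_
    have him : i ≤ m := Finset.le_sup (f := id) hi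
    refine SchwartzMap.seminorm_le_bound ℂ i.1 i.2 _
      (mul_nonneg (by positivity) (mul_nonneg (by positivity) (apply_nonneg _ _))) fun y => ?_
    have e : iteratedFDeriv ℝ i.2 (f.compSubConstCLM ℂ x) y = iteratedFDeriv ℝ i.2 f (y - x) :=
      iteratedFDeriv_comp_sub _ _ _
    rw [e]
    calc ‖y‖ ^ i.1 * ‖iteratedFDeriv ℝ i.2 f (y - x)‖
        ≤ (1 + ‖y‖) ^ m.1 * ‖iteratedFDeriv ℝ i.2 f (y - x)‖ := by
          gcongr
          calc ‖y‖ ^ i.1 ≤ (1 + ‖y‖) ^ i.1 := by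
                gcongr
                linarith
            _ ≤ (1 + ‖y‖) ^ m.1 := pow_le_pow_right₀ (by linarith [norm_nonneg y]) him.1
      _ ≤ ((1 + ‖x‖) * (1 + ‖y - x‖)) ^ m.1 * ‖iteratedFDeriv ℝ i.2 f (y - x)‖ := by
          gcongr
          exact one_add_norm_le_mul x y
      _ = (1 + ‖x‖) ^ m.1 * ((1 + ‖y - x‖) ^ m.1 * ‖iteratedFDeriv ℝ i.2 f (y - x)‖) := by
          rw [mul_pow, mul_assoc]
      _ ≤ _ := mul_le_mul_of_nonneg_left
          (one_add_le_sup_seminorm_apply (𝕜 := ℂ) le_rfl him.2 f (y - x)) (by positivity)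
  calc _ ≤ C * ((1 + ‖x‖) ^ m.1
      * (2 ^ m.1 * ((Finset.Iic m).sup (schwartzSeminormFamily ℂ (Rd d) ℂ)) f)) := by gcongr
    _ = _ := by ring

/-- Mean value inequality on the segment from `y` to `y - x`. One factor `2 ^ k` compares `1 + ‖y‖`
with `1 + ‖w‖` for `w` on the segment, which lies within distance `1` of `y`; the other comes from
passing from the weight `(1 + ‖w‖) ^ k` to Schwartz seminorms. -/
theorem seminorm_translate_sub_le (k n : ℕ) (f : 𝓢(Rd d, ℂ)) {x : Rd d} (hx : ‖x‖ ≤ 1) :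
    SchwartzMap.seminorm ℂ k n (f.compSubConstCLM ℂ x - f) ≤ ‖x‖ * (2 ^ k * (2 ^ k *
      ((Finset.Iic (k, n + 1)).sup (schwartzSeminormFamily ℂ (Rd d) ℂ)) f)) := by
  set M := ((Finset.Iic (k, n + 1)).sup (schwartzSeminormFamily ℂ (Rd d) ℂ)) f with hM
  have hM0 : 0 ≤ M := apply_nonneg _ _
  refine SchwartzMap.seminorm_le_bound ℂ k n _ (by positivity) fun y => ?_
  have e : iteratedFDeriv ℝ n (f.compSubConstCLM ℂ x - f : 𝓢(Rd d, ℂ)) y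
      = iteratedFDeriv ℝ n f (y - x) - iteratedFDeriv ℝ n f y := by
    change iteratedFDeriv ℝ n ((f.compSubConstCLM ℂ x : Rd d → ℂ) - (f : Rd d → ℂ)) y = _
    rw [iteratedFDeriv_sub_apply ((SchwartzMap.smooth _ n).contDiffAt) ((f.smooth n).contDiffAt)]
    congr 1
    exact iteratedFDeriv_comp_sub _ _ _
  rw [e]
  have hb : ∀ w ∈ segment ℝ y (y - x), ‖fderiv ℝ (iteratedFDeriv ℝ n f) w‖
      ≤ 2 ^ k * (2 ^ k * M) / (1 + ‖y‖) ^ k := by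
    intro w hw
    have hwx : ‖y - w‖ ≤ 1 := by
      obtain ⟨a, b, ha, hb, hab, rfl⟩ := hw
      have : y - (a • y + b • (y - x)) = b • x := by
        have : a = 1 - b := by linarith
        subst this
        module
      rw [this, norm_smul, Real.norm_of_nonneg hb]
      nlinarith [norm_nonneg x]
    rw [norm_fderiv_iteratedFDeriv, le_div_iff₀ (by positivity)]
    have h₁ := one_add_norm_le_mul w y
    have h₂ : (1 + ‖y‖) ^ k ≤ (2 * (1 + ‖w‖)) ^ k := by
      gcongr
      nlinarith [norm_nonneg w]
    have h₃ := one_add_le_sup_seminorm_apply (𝕜 := ℂ) (m := (k, n + 1)) (k := k) (n := n + 1)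
      le_rfl le_rfl f w
    calc ‖iteratedFDeriv ℝ (n + 1) f w‖ * (1 + ‖y‖) ^ k
        ≤ ‖iteratedFDeriv ℝ (n + 1) f w‖ * (2 * (1 + ‖w‖)) ^ k := by gcongr
      _ = 2 ^ k * ((1 + ‖w‖) ^ k * ‖iteratedFDeriv ℝ (n + 1) f w‖) := by
        rw [mul_pow]
        ring
      _ ≤ _ := mul_le_mul_of_nonneg_left h₃ (by positivity)
  have hmv := (convex_segment y (y - x)).norm_image_sub_le_of_norm_fderiv_le (𝕜 := ℝ)
    (f := iteratedFDeriv ℝ n f)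
    (fun w _ => ((f.smooth (n + 1 : ℕ)).differentiable_iteratedFDeriv
      (mod_cast Nat.lt_succ_self n)) w) hb (left_mem_segment ℝ y (y - x))
    (right_mem_segment ℝ y (y - x))
  have hx' : ‖y - x - y‖ = ‖x‖ := by
    rw [sub_sub_cancel_left, norm_neg]
  rw [hx'] at hmv
  calc ‖y‖ ^ k * _ ≤ (1 + ‖y‖) ^ k * (2 ^ k * (2 ^ k * M) / (1 + ‖y‖) ^ k * ‖x‖) := by
        gcongr
        linarith
    _ = _ := by
        field_simp

/-- The preceding estimate gives continuity at `0` for every function; at `x₀` it is applied to the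
function translated by `x₀`. -/
theorem continuous_translate (f : 𝓢(Rd d, ℂ)) :
    Continuous fun x : Rd d => f.compSubConstCLM ℂ x := by
  have h0 : ∀ f : 𝓢(Rd d, ℂ),
      Filter.Tendsto (fun x : Rd d => f.compSubConstCLM ℂ x) (nhds 0) (nhds f) := by
    intro f
    rw [(schwartz_withSeminorms ℂ (Rd d) ℂ).tendsto_nhds]
    intro i ε hε
    set M := 2 ^ i.1 * (2 ^ i.1 *
      ((Finset.Iic (i.1, i.2 + 1)).sup (schwartzSeminormFamily ℂ (Rd d) ℂ)) f) with hM
    have ht : Filter.Tendsto (fun x : Rd d => ‖x‖ * M) (nhds 0) (nhds 0) := by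
      have : Continuous fun x : Rd d => ‖x‖ * M := by fun_prop
      simpa using this.tendsto 0
    filter_upwards [ht.eventually_lt_const hε, Metric.closedBall_mem_nhds (0 : Rd d) one_pos]
      with x hx hx1
    exact (seminorm_translate_sub_le i.1 i.2 f (by simpa using hx1)).trans_lt hx
  rw [continuous_iff_continuousAt]
  intro x₀
  have h1 : Filter.Tendsto (fun x : Rd d => x - x₀) (nhds x₀) (nhds 0) := by
    have : Continuous fun x : Rd d => x - x₀ := by fun_prop
    simpa using this.tendsto x₀
  have h2 := (h0 (f.compSubConstCLM ℂ x₀)).comp h1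
  refine h2.congr fun x => ?_
  ext y
  simp [SchwartzMap.compSubConstCLM_apply]

/-- The increment splits into a translate of `Ψ w - Ψ w₀`, small by the polynomial bound on
translations, and an increment of translates of the fixed function `Ψ w₀`. -/
theorem continuous_translate_comp {W : Type*} [TopologicalSpace W] {Ψ : W → 𝓢(Rd d, ℂ)}
    {b : W → Rd d} (hΨ : Continuous Ψ) (hb : Continuous b) :
    Continuous fun w => (Ψ w).compSubConstCLM ℂ (b w) := by
  rw [continuous_iff_continuousAt]
  intro w₀
  rw [ContinuousAt, (schwartz_withSeminorms ℂ (Rd d) ℂ).tendsto_nhds]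
  intro i ε hε
  set p := schwartzSeminormFamily ℂ (Rd d) ℂ i
  have hp : Continuous p := (schwartz_withSeminorms ℂ (Rd d) ℂ).continuous_seminorm i
  obtain ⟨N, q, hq, hN⟩ := exists_seminorm_translate_le p hp
  have h₁ : Filter.Tendsto (fun w => (1 + ‖b w‖) ^ N * q (Ψ w - Ψ w₀)) (nhds w₀) (nhds 0) := by
    have hc : Continuous fun w => (1 + ‖b w‖) ^ N * q (Ψ w - Ψ w₀) :=
      ((continuous_const.add hb.norm).pow N).mul (hq.comp (hΨ.sub continuous_const))
    simpa using hc.tendsto w₀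
  have h₂ : Filter.Tendsto (fun w => p ((Ψ w₀).compSubConstCLM ℂ (b w)
      - (Ψ w₀).compSubConstCLM ℂ (b w₀))) (nhds w₀) (nhds 0) := by
    have hc : Continuous fun w => p ((Ψ w₀).compSubConstCLM ℂ (b w)
      - (Ψ w₀).compSubConstCLM ℂ (b w₀)) :=
      hp.comp (((continuous_translate (Ψ w₀)).comp hb).sub continuous_const)
    simpa using hc.tendsto w₀
  have h := h₁.add h₂
  rw [add_zero] at h
  filter_upwards [h.eventually_lt_const hε] with w hw
  refine lt_of_le_of_lt ?_ hw
  have e : (Ψ w).compSubConstCLM ℂ (b w) - (Ψ w₀).compSubConstCLM ℂ (b w₀)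
      = (Ψ w - Ψ w₀).compSubConstCLM ℂ (b w) + ((Ψ w₀).compSubConstCLM ℂ (b w)
      - (Ψ w₀).compSubConstCLM ℂ (b w₀)) := by
    rw [map_sub]
    abel
  rw [e]
  exact (map_add_le_add p _ _).trans (add_le_add (hN _ _) le_rfl)

-- With the Fourier kernel `e^{-2πi⟨y, η⟩}`, modulation by `ξ` becomes translation by `ξ / 2π`.
-- Continuity and seminorm bounds for modulations thus reduce to those for translations.
open FourierTransform in
theorem tfShift_eq_fourierInv (x ξ : Rd d) (f : 𝓢(Rd d, ℂ)) :
    tfShift x ξ f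
      = 𝓕⁻ ((𝓕 (f.compSubConstCLM ℂ x)).compSubConstCLM ℂ ((2 * Real.pi)⁻¹ • ξ)) := by
  set g := f.compSubConstCLM ℂ x with hg
  have : 𝓕 (tfShift x ξ f) = (𝓕 g).compSubConstCLM ℂ ((2 * Real.pi)⁻¹ • ξ) := by
    ext η
    rw [SchwartzMap.compSubConstCLM_apply, SchwartzMap.fourier_coe, SchwartzMap.fourier_coe,
      Real.fourier_eq', Real.fourier_eq']
    congr 1 with y
    rw [tfShift_apply, hg, SchwartzMap.compSubConstCLM_apply, smul_eq_mul, smul_eq_mul,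
      ← mul_assoc, ← Complex.exp_add]
    congr 2
    rw [inner_sub_right, inner_smul_right]
    push_cast
    have hpi : (Real.pi : ℂ) ≠ 0 := by exact_mod_cast Real.pi_ne_zero
    field_simp
    ring
  rw [← this, FourierPair.fourierInv_fourier_eq]

open FourierTransform in
theorem continuous_tfShift (f : 𝓢(Rd d, ℂ)) :
    Continuous fun z : Rd d × Rd d => tfShift z.1 z.2 f := by
  simp only [tfShift_eq_fourierInv]
  refine (FourierTransform.fourierInvCLM ℂ 𝓢(Rd d, ℂ)).continuous.comp ?_
  refine continuous_translate_comp ?_ (by fun_prop)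
  exact (FourierTransform.fourierCLM ℂ 𝓢(Rd d, ℂ)).continuous.comp
    ((continuous_translate f).comp continuous_fst)

open FourierTransform in
/-- Time-frequency shifts act on the Schwartz space with polynomially bounded seminorms. -/
theorem exists_seminorm_tfShift_le (p : Seminorm ℂ 𝓢(Rd d, ℂ)) (hp : Continuous p) :
    ∃ (N : ℕ) (q : Seminorm ℂ 𝓢(Rd d, ℂ)), Continuous q ∧
      ∀ (z : Rd d × Rd d) f, p (tfShift z.1 z.2 f) ≤ (1 + ‖z‖) ^ N * q f := by
  let F := FourierTransform.fourierCLM ℂ 𝓢(Rd d, ℂ)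
  let G := FourierTransform.fourierInvCLM ℂ 𝓢(Rd d, ℂ)
  obtain ⟨N₁, q₁, hq₁, h₁⟩ := exists_seminorm_translate_le (p.comp G.toLinearMap)
    (hp.comp G.continuous)
  obtain ⟨N₂, q₂, hq₂, h₂⟩ := exists_seminorm_translate_le (q₁.comp F.toLinearMap)
    (hq₁.comp F.continuous)
  refine ⟨N₁ + N₂, q₂, hq₂, fun z f => ?_⟩
  rw [tfShift_eq_fourierInv]
  have hz₁ : ‖(2 * Real.pi)⁻¹ • z.2‖ ≤ ‖z‖ := by
    rw [norm_smul, Real.norm_of_nonneg (by positivity)]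
    have hpi : (2 * Real.pi)⁻¹ ≤ 1 := inv_le_one_of_one_le₀ (by linarith [Real.pi_gt_three])
    calc (2 * Real.pi)⁻¹ * ‖z.2‖ ≤ 1 * ‖z‖ := by
          gcongr
          exact norm_snd_le z
      _ = ‖z‖ := one_mul _
  calc p (𝓕⁻ ((𝓕 (f.compSubConstCLM ℂ z.1)).compSubConstCLM ℂ ((2 * Real.pi)⁻¹ • z.2)))
      ≤ (1 + ‖(2 * Real.pi)⁻¹ • z.2‖) ^ N₁ * q₁ (𝓕 (f.compSubConstCLM ℂ z.1)) := h₁ _ _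
    _ ≤ (1 + ‖z‖) ^ N₁ * ((1 + ‖z.1‖) ^ N₂ * q₂ f) := by
      gcongr
      exact h₂ z.1 f
    _ ≤ (1 + ‖z‖) ^ N₁ * ((1 + ‖z‖) ^ N₂ * q₂ f) := by
      gcongr
      exact norm_fst_le z
    _ = _ := by
      rw [pow_add, mul_assoc]

end Shifts

/-! ### The weight and the symbols -/

section Weight

variable {d : ℕ}

theorem one_le_theta (σ : ℝ) (z : Rd d × Rd d) : 1 ≤ theta σ z := by
  unfold theta
  have : 0 ≤ ‖z.2‖ ^ (1 / σ) := by positivity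
  linarith [norm_nonneg z.1]

theorem continuous_theta {σ : ℝ} (hσ : 0 < σ) : Continuous (theta (d := d) σ) := by
  unfold theta
  have : Continuous fun z : Rd d × Rd d => ‖z.2‖ ^ (1 / σ) :=
    continuous_snd.norm.rpow_const fun _ => Or.inr (by positivity)
  fun_prop

theorem continuous_theta_rpow {σ : ℝ} (hσ : 0 < σ) (s : ℝ) :
    Continuous fun z : Rd d × Rd d => theta σ z ^ s :=
  (continuous_theta hσ).rpow_const fun z => Or.inl (ShubinSobolev.theta_pos σ z).ne'

theorem add_rpow_le_two_rpow_mul {a b p : ℝ} (ha : 0 ≤ a) (hb : 0 ≤ b) (hp : 0 ≤ p) :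
    (a + b) ^ p ≤ 2 ^ p * (a ^ p + b ^ p) := by
  have ha' : 0 ≤ a ^ p := by positivity
  have hb' : 0 ≤ b ^ p := by positivity
  rcases le_total a b with h | h
  · calc (a + b) ^ p ≤ (2 * b) ^ p := Real.rpow_le_rpow (by positivity) (by linarith) hp
      _ = 2 ^ p * b ^ p := Real.mul_rpow (by norm_num) hb
      _ ≤ _ := by
        gcongr
        linarith
  · calc (a + b) ^ p ≤ (2 * a) ^ p := Real.rpow_le_rpow (by positivity) (by linarith) hp
      _ = 2 ^ p * a ^ p := Real.mul_rpow (by norm_num) ha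
      _ ≤ _ := by
        gcongr
        linarith

/-- The power `1 / σ` satisfies a quasi-triangle inequality with factor `2 ^ (1 / σ)`. Since `θ_σ`
and the power of `1 + ‖w‖` are at least `1`, the resulting sum is at most three times their product.
The `+ 1` in the exponent also accommodates the linear term `‖w.1‖`. -/
theorem exists_theta_add_le {σ : ℝ} (hσ : 0 < σ) : ∃ (C : ℝ) (L : ℕ), 1 ≤ C ∧
    ∀ z w : Rd d × Rd d, theta σ (z + w) ≤ C * (1 + ‖w‖) ^ L * theta σ z := by
  set p := 1 / σ with hp
  have hp0 : 0 < p := by positivity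
  have h2 : (1 : ℝ) ≤ 2 ^ p := Real.one_le_rpow one_le_two hp0.le
  refine ⟨3 * 2 ^ p, ⌈p⌉₊ + 1, by linarith, fun z w => ?_⟩
  set R := (1 + ‖w‖) ^ (⌈p⌉₊ + 1) with hR
  have hw1 : 1 ≤ 1 + ‖w‖ := by linarith [norm_nonneg w]
  have hR1 : 1 ≤ R := one_le_pow₀ hw1
  have e₁ : ‖w.1‖ ≤ R := by
    calc ‖w.1‖ ≤ (1 + ‖w‖) ^ 1 := by
          rw [pow_one]
          linarith [norm_fst_le w]
      _ ≤ R := pow_le_pow_right₀ hw1 (by omega)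
  have e₂ : ‖w.2‖ ^ p ≤ R := by
    calc ‖w.2‖ ^ p ≤ (1 + ‖w‖) ^ p :=
          Real.rpow_le_rpow (norm_nonneg _) (by linarith [norm_snd_le w]) hp0.le
      _ ≤ (1 + ‖w‖) ^ ((⌈p⌉₊ + 1 : ℕ) : ℝ) := by
          refine Real.rpow_le_rpow_of_exponent_le hw1 ?_
          push_cast
          linarith [Nat.le_ceil p]
      _ = R := Real.rpow_natCast _ _
  have e₃ : ‖(z + w).2‖ ^ p ≤ 2 ^ p * (‖z.2‖ ^ p + ‖w.2‖ ^ p) :=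
    (Real.rpow_le_rpow (norm_nonneg _) (norm_add_le _ _) hp0.le).trans
      (add_rpow_le_two_rpow_mul (norm_nonneg _) (norm_nonneg _) hp0.le)
  have e₄ : ‖(z + w).1‖ ≤ ‖z.1‖ + ‖w.1‖ := norm_add_le _ _
  have hz : 1 ≤ theta σ z := one_le_theta σ z
  have key : theta σ (z + w) ≤ 2 ^ p * (theta σ z + 2 * R) := by
    unfold theta
    rw [← hp]
    nlinarith [norm_nonneg z.1]
  calc theta σ (z + w) ≤ 2 ^ p * (theta σ z + 2 * R) := key
    _ ≤ 2 ^ p * (theta σ z * R + 2 * (R * theta σ z)) := by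
      gcongr
      · nlinarith
      · nlinarith
    _ = _ := by ring

/-- Powers of the weight are polynomially moderate. -/
theorem exists_theta_add_rpow_le {σ : ℝ} (hσ : 0 < σ) (m : ℝ) : ∃ (C : ℝ) (L : ℕ), 0 < C ∧
    ∀ z w : Rd d × Rd d, theta σ (z + w) ^ m ≤ C * (1 + ‖w‖) ^ L * theta σ z ^ m := by
  obtain ⟨C, L, hC, h⟩ := exists_theta_add_le (d := d) hσ
  refine ⟨C ^ |m|, ⌈L * |m|⌉₊, by positivity, fun z w => ?_⟩
  have hw1 : 1 ≤ 1 + ‖w‖ := by linarith [norm_nonneg w]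
  set R := C * (1 + ‖w‖) ^ L with hR
  have hR0 : 0 < R := by positivity
  have hz := ShubinSobolev.theta_pos σ z
  have hzw := ShubinSobolev.theta_pos σ (z + w)
  have h₁ : theta σ (z + w) ≤ R * theta σ z := h z w
  -- The same inequality read backwards, from `z + w` by `-w`, which serves for negative exponents.
  have h₂ : theta σ z ≤ R * theta σ (z + w) := by
    have := h (z + w) (-w)
    rwa [add_neg_cancel_right, norm_neg] at this
  have key : theta σ (z + w) ^ m ≤ R ^ |m| * theta σ z ^ m := by
    rcases le_total 0 m with hm | hm
    · rw [abs_of_nonneg hm, ← Real.mul_rpow hR0.le hz.le]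
      exact Real.rpow_le_rpow hzw.le h₁ hm
    · rw [abs_of_nonpos hm]
      have : (R * theta σ (z + w)) ^ m ≤ theta σ z ^ m :=
        Real.rpow_le_rpow_of_nonpos hz h₂ hm
      rw [Real.mul_rpow hR0.le hzw.le] at this
      calc theta σ (z + w) ^ m = R ^ (-m) * (R ^ m * theta σ (z + w) ^ m) := by
            rw [← mul_assoc, ← Real.rpow_add hR0, neg_add_cancel, Real.rpow_zero, one_mul]
        _ ≤ _ := by gcongr
  refine key.trans ?_
  have e : R ^ |m| ≤ C ^ |m| * (1 + ‖w‖) ^ ⌈L * |m|⌉₊ := by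
    rw [hR, Real.mul_rpow (by positivity) (by positivity), ← Real.rpow_natCast (1 + ‖w‖) L,
      ← Real.rpow_mul (by positivity), ← Real.rpow_natCast (1 + ‖w‖) ⌈L * |m|⌉₊]
    gcongr
    · exact Nat.le_ceil _
  exact mul_le_mul_of_nonneg_right e (by positivity)

/-- Continuous functions on phase space bounded by a multiple of `θ_σ ^ m`. -/
def BoundedByWeight (m σ : ℝ) (b : Rd d × Rd d → ℂ) : Prop :=
  Continuous b ∧ ∃ C : ℝ, 0 ≤ C ∧ ∀ z, ‖b z‖ ≤ C * theta σ z ^ m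

/-- The `k`-th derivative of `a` in direction `v`. -/
def iterDeriv (a : Rd d × Rd d → ℂ) (v : Rd d × Rd d) (k : ℕ) (z : Rd d × Rd d) : ℂ :=
  iteratedFDeriv ℝ k a z fun _ => v

theorem iterDeriv_zero (a : Rd d × Rd d → ℂ) (v : Rd d × Rd d) : iterDeriv a v 0 = a := by
  ext z
  simp [iterDeriv]

theorem hasLineDerivAt_iterDeriv {a : Rd d × Rd d → ℂ} (ha : ContDiff ℝ ∞ a) (v : Rd d × Rd d)
    (k : ℕ) (z : Rd d × Rd d) :
    HasLineDerivAt ℝ (iterDeriv a v k) (iterDeriv a v (k + 1) z) z v := by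
  have h : HasFDerivAt (iteratedFDeriv ℝ k a) (fderiv ℝ (iteratedFDeriv ℝ k a) z) z :=
    (ha.differentiable_iteratedFDeriv (mod_cast WithTop.coe_lt_top k) z).hasFDerivAt
  have h' := ((ContinuousMultilinearMap.apply ℝ (fun _ : Fin k => Rd d × Rd d) ℂ
    (fun _ => v)).hasFDerivAt.comp z h).hasLineDerivAt v
  have e : iterDeriv a v (k + 1) z
      = fderiv ℝ (iteratedFDeriv ℝ k a) z v fun _ => v := by
    rw [iterDeriv, iteratedFDeriv_succ_apply_left]
    rfl
  rw [e]
  exact h'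

theorem continuous_iterDeriv {a : Rd d × Rd d → ℂ} (ha : ContDiff ℝ ∞ a) (v : Rd d × Rd d)
    (k : ℕ) : Continuous (iterDeriv a v k) :=
  (ContinuousMultilinearMap.apply ℝ (fun _ : Fin k => Rd d × Rd d) ℂ
    (fun _ => v)).continuous.comp (ha.continuous_iteratedFDeriv (mod_cast le_top))

theorem boundedByWeight_of_le {m m' σ : ℝ} {b : Rd d × Rd d → ℂ} (hb : Continuous b)
    (h : ∃ C : ℝ, ∀ z, ‖b z‖ ≤ C * theta σ z ^ m') (hm : m' ≤ m) : BoundedByWeight m σ b := by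
  obtain ⟨C, hC⟩ := h
  refine ⟨hb, |C|, abs_nonneg C, fun z => (hC z).trans ?_⟩
  have h₁ : theta σ z ^ m' ≤ theta σ z ^ m :=
    Real.rpow_le_rpow_of_exponent_le (one_le_theta σ z) hm
  have h₀ : 0 ≤ theta σ z ^ m' := Real.rpow_nonneg (ShubinSobolev.theta_pos σ z).le _
  exact mul_le_mul (le_abs_self C) h₁ h₀ (abs_nonneg C)

theorem IsSymbol.boundedByWeight {m σ : ℝ} {a : Rd d × Rd d → ℂ} (ha : IsSymbol m σ a) : BoundedByWeight m σ a := by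
  obtain ⟨C, hC⟩ := ha.2 0 0 Fin.elim0 Fin.elim0
  refine boundedByWeight_of_le (m' := m - (0 : ℕ) - σ * (0 : ℕ)) ha.1.continuous
    ⟨C, fun z => ?_⟩ (by simp)
  simpa [phasePartial] using hC z

/-- The gain in order under differentiation is discarded, as `θ_σ ≥ 1`. Only repeated derivatives in
a single coordinate direction occur later, since decay is tested coordinate by coordinate. -/
theorem IsSymbol.boundedByWeight_fst {m σ : ℝ} {a : Rd d × Rd d → ℂ} (ha : IsSymbol m σ a)
    (r : Fin d) (k : ℕ) :
    BoundedByWeight m σ (iterDeriv a (EuclideanSpace.single r (1 : ℝ), 0) k) := by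
  obtain ⟨C, hC⟩ := ha.2 k 0 (fun _ => r) Fin.elim0
  refine boundedByWeight_of_le (m' := m - k - σ * (0 : ℕ)) (continuous_iterDeriv ha.1 _ _)
    ⟨C, fun z => ?_⟩ (by simp)
  refine le_trans (le_of_eq ?_) (hC z)
  rw [phasePartial, iterDeriv]
  congr 2
  ext1 i
  exact (Fin.append_left (m := k) (n := 0)
    (fun _ => ((EuclideanSpace.single r (1 : ℝ) : Rd d), (0 : Rd d)))
    (fun n => ((0 : Rd d), (EuclideanSpace.single n.elim0 (1 : ℝ) : Rd d))) i).symm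

theorem IsSymbol.boundedByWeight_snd {m σ : ℝ} (hσ : 0 < σ) {a : Rd d × Rd d → ℂ}
    (ha : IsSymbol m σ a) (r : Fin d) (k : ℕ) :
    BoundedByWeight m σ (iterDeriv a (0, EuclideanSpace.single r (1 : ℝ)) k) := by
  obtain ⟨C, hC⟩ := ha.2 0 k Fin.elim0 (fun _ => r)
  refine boundedByWeight_of_le (m' := m - (0 : ℕ) - σ * k) (continuous_iterDeriv ha.1 _ _)
    ⟨C, fun z => ?_⟩ (by
      have : 0 ≤ σ * k := by positivity
      simpa using this)
  refine le_trans (le_of_eq ?_) (hC z)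
  -- The derivative in `phasePartial` has order `0 + k`, which has to be transported to `k`.
  have hk : ∀ n, n = k → iteratedFDeriv ℝ k a z
      (fun _ => ((0 : Rd d), (EuclideanSpace.single r (1 : ℝ) : Rd d)))
      = iteratedFDeriv ℝ n a z (fun _ => (0, EuclideanSpace.single r (1 : ℝ))) := by
    rintro n rfl
    rfl
  rw [phasePartial, iterDeriv, hk (0 + k) (zero_add k)]
  congr 2
  ext1 i
  refine Fin.addCases (fun i => i.elim0) (fun i => ?_) i
  rw [Fin.append_right]

end Weight

/-! ### Weyl forms and their matrix elements with respect to time-frequency shifts -/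

section WeylForm

variable {d : ℕ}

/-- The sesquilinear form `(b^w(x, D) f, g)` of Weyl quantization. -/
def weylForm (b : Rd d × Rd d → ℂ) (f g : 𝓢(Rd d, ℂ)) : ℂ :=
  (((2 * Real.pi) ^ (-(d : ℝ)) : ℝ) : ℂ) * ∫ z : Rd d × Rd d, b z * conj (crossWigner g f z)

theorem norm_exp_I_mul (t : ℝ) : ‖Complex.exp (Complex.I * (t : ℂ))‖ = 1 := by
  rw [mul_comm, Complex.norm_exp_ofReal_mul_I]

/-- Covariance of the Wigner distribution. After the substitution `y ↦ y + (z.1 - w.1)` the shifts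
amount to a translation by the midpoint of `z` and `w`, with a phase that does not depend on `y` and
so leaves the integral. -/
theorem wignerKernel_tfShift (z w p : Rd d × Rd d) (g f : 𝓢(Rd d, ℂ)) (y : Rd d) :
    wignerKernel (tfShift z.1 z.2 g) (tfShift w.1 w.2 f) p (y + (z.1 - w.1))
      = Complex.exp (Complex.I * ((inner ℝ (p.1 + (1 / 2 : ℝ) • (z.1 - w.1)) z.2
          - inner ℝ (p.1 - (1 / 2 : ℝ) • (z.1 - w.1)) w.2 - inner ℝ (z.1 - w.1) p.2 : ℝ) : ℂ))
        * wignerKernel g f (p - (1 / 2 : ℝ) • (z + w)) y := by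
  have e₁ : p.1 + (1 / 2 : ℝ) • (y + (z.1 - w.1)) - z.1
      = (p - (1 / 2 : ℝ) • (z + w)).1 + (1 / 2 : ℝ) • y := by
    simp only [Prod.fst_sub, Prod.smul_fst, Prod.fst_add]
    module
  have e₂ : p.1 - (1 / 2 : ℝ) • (y + (z.1 - w.1)) - w.1
      = (p - (1 / 2 : ℝ) • (z + w)).1 - (1 / 2 : ℝ) • y := by
    simp only [Prod.fst_sub, Prod.smul_fst, Prod.fst_add]
    module
  have e₃ : Complex.exp (Complex.I * (inner ℝ (p.1 + (1 / 2 : ℝ) • (y + (z.1 - w.1))) z.2 : ℝ))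
      * conj (Complex.exp (Complex.I * (inner ℝ (p.1 - (1 / 2 : ℝ) • (y + (z.1 - w.1))) w.2 : ℝ)))
      * Complex.exp (-(Complex.I * (inner ℝ (y + (z.1 - w.1)) p.2 : ℝ)))
      = Complex.exp (Complex.I * ((inner ℝ (p.1 + (1 / 2 : ℝ) • (z.1 - w.1)) z.2
          - inner ℝ (p.1 - (1 / 2 : ℝ) • (z.1 - w.1)) w.2 - inner ℝ (z.1 - w.1) p.2 : ℝ) : ℂ))
        * Complex.exp (-(Complex.I * (inner ℝ y (p - (1 / 2 : ℝ) • (z + w)).2 : ℝ))) := by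
    rw [← Complex.exp_conj, ← Complex.exp_add, ← Complex.exp_add, ← Complex.exp_add]
    congr 1
    rw [map_mul, Complex.conj_I, Complex.conj_ofReal]
    simp only [Prod.snd_sub, Prod.smul_snd, Prod.snd_add, inner_add_left, inner_sub_left,
      inner_add_right, inner_sub_right, real_inner_smul_left, real_inner_smul_right]
    push_cast
    ring
  rw [wignerKernel, wignerKernel, tfShift_apply, tfShift_apply, e₁, e₂, map_mul]
  linear_combination (g ((p - (1 / 2 : ℝ) • (z + w)).1 + (1 / 2 : ℝ) • y)
    * conj (f ((p - (1 / 2 : ℝ) • (z + w)).1 - (1 / 2 : ℝ) • y))) * e₃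

theorem norm_crossWigner_tfShift (z w p : Rd d × Rd d) (g f : 𝓢(Rd d, ℂ)) :
    ‖crossWigner (tfShift z.1 z.2 g) (tfShift w.1 w.2 f) p‖
      = ‖crossWigner g f (p - (1 / 2 : ℝ) • (z + w))‖ := by
  rw [crossWigner_eq, ← integral_add_right_eq_self _ (z.1 - w.1)]
  simp only [wignerKernel_tfShift]
  rw [integral_const_mul, norm_mul, norm_exp_I_mul, one_mul, crossWigner_eq]

instance isAddHaarMeasure_volume_phase :
    (volume : Measure (Rd d × Rd d)).IsAddHaarMeasure :=
  inferInstanceAs ((volume : Measure (Rd d)).prod volume).IsAddHaarMeasure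

theorem finrank_phase_lt : Module.finrank ℝ (Rd d × Rd d) < 2 * d + 1 := by
  simp
  omega

theorem integrable_phase_weight :
    Integrable fun p : Rd d × Rd d => ((1 + ‖p‖) ^ (2 * d + 1))⁻¹ :=
  integrable_inv_one_add_norm_pow finrank_phase_lt

/-- The integrand of a Weyl form between time-frequency shifts is concentrated near the midpoint. -/
theorem exists_weylForm_integrand_le {m σ : ℝ} (hσ : 0 < σ) {b : Rd d × Rd d → ℂ}
    (hb : BoundedByWeight m σ b) :
    ∃ q₁ q₂ : Seminorm ℂ 𝓢(Rd d, ℂ), Continuous q₁ ∧ Continuous q₂ ∧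
      ∀ g f (z w p : Rd d × Rd d),
        ‖b p * conj (crossWigner (tfShift z.1 z.2 g) (tfShift w.1 w.2 f) p)‖
          ≤ theta σ ((1 / 2 : ℝ) • (z + w)) ^ m * (q₁ g * q₂ f)
            * ((1 + ‖p - (1 / 2 : ℝ) • (z + w)‖) ^ (2 * d + 1))⁻¹ := by
  obtain ⟨-, C, hC, hbC⟩ := hb
  obtain ⟨C', L, hC', hθ⟩ := exists_theta_add_rpow_le (d := d) hσ m
  -- Of the decay, `L` powers pay for moving the weight from `p` to the midpoint, and `2 * d + 1`
  -- powers remain for integrability on `ℝ²ᵈ`.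
  obtain ⟨q₁, q₂, h₁, h₂, hq⟩ := (dominated_pow_mul_crossWigner (d := d)
    (L + (2 * d + 1))).const_mul (mul_nonneg hC hC'.le)
  refine ⟨q₁, q₂, h₁, h₂, fun g f z w p => ?_⟩
  set c := (1 / 2 : ℝ) • (z + w) with hc
  rw [norm_mul, RCLike.norm_conj, norm_crossWigner_tfShift, ← hc, ← div_eq_mul_inv,
    le_div_iff₀ (by positivity)]
  have e₁ : theta σ p ^ m ≤ C' * (1 + ‖p - c‖) ^ L * theta σ c ^ m := by
    simpa using hθ c (p - c)
  have hθc : 0 ≤ theta σ c ^ m := Real.rpow_nonneg (ShubinSobolev.theta_pos σ c).le _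
  calc ‖b p‖ * ‖crossWigner g f (p - c)‖ * (1 + ‖p - c‖) ^ (2 * d + 1)
      ≤ (C * (C' * (1 + ‖p - c‖) ^ L * theta σ c ^ m)) * ‖crossWigner g f (p - c)‖
        * (1 + ‖p - c‖) ^ (2 * d + 1) := by
        gcongr
        exact (hbC p).trans (by gcongr)
    _ = theta σ c ^ m * (C * C' * ((1 + ‖p - c‖) ^ (L + (2 * d + 1))
        * ‖crossWigner g f (p - c)‖)) := by
        rw [pow_add]
        ring
    _ ≤ _ := mul_le_mul_of_nonneg_left (hq g f (p - c)) hθc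

theorem tfShift_zero (f : 𝓢(Rd d, ℂ)) : tfShift 0 0 f = f := by
  ext y
  simp [tfShift_apply]

theorem integrable_weylForm {m σ : ℝ} (hσ : 0 < σ) {b : Rd d × Rd d → ℂ}
    (hb : BoundedByWeight m σ b) (f g : 𝓢(Rd d, ℂ)) :
    Integrable fun z => b z * conj (crossWigner g f z) := by
  obtain ⟨q₁, q₂, -, -, h⟩ := exists_weylForm_integrand_le hσ hb
  refine (integrable_phase_weight.const_mul
    (theta σ (0 : Rd d × Rd d) ^ m * (q₁ g * q₂ f))).mono' ?_
    (Filter.Eventually.of_forall fun p => ?_)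
  · exact (hb.1.mul (Complex.continuous_conj.comp (continuous_crossWigner g f))).aestronglyMeasurable
  · simpa [tfShift_zero] using h g f 0 0 p

theorem weylForm_add_left {m σ : ℝ} (hσ : 0 < σ) {b : Rd d × Rd d → ℂ}
    (hb : BoundedByWeight m σ b) (f₁ f₂ g : 𝓢(Rd d, ℂ)) :
    weylForm b (f₁ + f₂) g = weylForm b f₁ g + weylForm b f₂ g := by
  simp only [weylForm]
  rw [← mul_add, ← integral_add (integrable_weylForm hσ hb _ _) (integrable_weylForm hσ hb _ _)]
  congr 2 with z
  rw [crossWigner_add_right, map_add, mul_add]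

theorem weylForm_add_right {m σ : ℝ} (hσ : 0 < σ) {b : Rd d × Rd d → ℂ}
    (hb : BoundedByWeight m σ b) (f g₁ g₂ : 𝓢(Rd d, ℂ)) :
    weylForm b f (g₁ + g₂) = weylForm b f g₁ + weylForm b f g₂ := by
  simp only [weylForm]
  rw [← mul_add, ← integral_add (integrable_weylForm hσ hb _ _) (integrable_weylForm hσ hb _ _)]
  congr 2 with z
  rw [crossWigner_add_left, map_add, mul_add]

theorem weylForm_smul_left (b : Rd d × Rd d → ℂ) (c : ℂ) (f g : 𝓢(Rd d, ℂ)) :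
    weylForm b (c • f) g = c * weylForm b f g := by
  simp only [weylForm]
  rw [mul_left_comm, ← integral_const_mul c]
  congr 2 with z
  rw [crossWigner_smul_right, map_mul, Complex.conj_conj]
  ring

theorem weylForm_smul_right (b : Rd d × Rd d → ℂ) (c : ℂ) (f g : 𝓢(Rd d, ℂ)) :
    weylForm b f (c • g) = conj c * weylForm b f g := by
  simp only [weylForm]
  rw [mul_left_comm, ← integral_const_mul (conj c)]
  congr 2 with z
  rw [crossWigner_smul_left, map_mul]
  ring

/-- Integration by parts in a Weyl form. -/
theorem weylForm_lineDeriv {m σ : ℝ} (hσ : 0 < σ) {b b' : Rd d × Rd d → ℂ}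
    (hb : BoundedByWeight m σ b) (hb' : BoundedByWeight m σ b') (v w : Rd d)
    (hd : ∀ z, HasLineDerivAt ℝ b (b' z) z (v, w)) (f g : 𝓢(Rd d, ℂ)) :
    weylForm b' f g = -(weylForm b f (derivDir v g) + weylForm b (derivDir v f) g)
      - Complex.I * (weylForm b f (mulInner w g) - weylForm b (mulInner w f) g) := by
  have i₁ := integrable_weylForm hσ hb f (derivDir v g)
  have i₂ := integrable_weylForm hσ hb (derivDir v f) g
  have i₃ := integrable_weylForm hσ hb f (mulInner w g)
  have i₄ := integrable_weylForm hσ hb (mulInner w f) g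
  let W' : Rd d × Rd d → ℂ := fun z => conj (crossWigner (derivDir v g) f z
    + crossWigner g (derivDir v f) z
    - Complex.I * (crossWigner (mulInner w g) f z - crossWigner g (mulInner w f) z))
  have hW : ∀ z, HasLineDerivAt ℝ (fun z => conj (crossWigner g f z)) (W' z) z (v, w) :=
    fun z => hasDerivAt_conj (hasLineDerivAt_crossWigner v w g f z)
  have e : ∀ z, b z * W' z = (b z * conj (crossWigner (derivDir v g) f z)
      + b z * conj (crossWigner g (derivDir v f) z))
      + Complex.I * (b z * conj (crossWigner (mulInner w g) f z)
        - b z * conj (crossWigner g (mulInner w f) z)) := by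
    intro z
    simp only [W', map_sub, map_add, map_mul, Complex.conj_I]
    ring
  have i₅ : Integrable fun z => b z * conj (crossWigner (mulInner w g) f z)
        - b z * conj (crossWigner g (mulInner w f) z) := i₃.sub i₄
  have i₆ : Integrable fun z => b z * conj (crossWigner (derivDir v g) f z)
      + b z * conj (crossWigner g (derivDir v f) z) := i₁.add i₂
  have ibp := integral_bilinear_hasLineDerivAt_right_eq_neg_left_of_integrable
    (B := ContinuousLinearMap.mul ℝ ℂ) (f := b) (f' := b')
    (g := fun z => conj (crossWigner g f z)) (g' := W') (v := (v, w)) (μ := volume)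
    (by
      simp only [ContinuousLinearMap.mul_apply']
      exact integrable_weylForm hσ hb' f g)
    (by
      simp only [ContinuousLinearMap.mul_apply', e]
      exact i₆.add (i₅.const_mul _))
    (by
      simp only [ContinuousLinearMap.mul_apply']
      exact integrable_weylForm hσ hb f g)
    (fun z _ => hd z) (fun z _ => hW z)
  simp only [ContinuousLinearMap.mul_apply', e] at ibp
  rw [integral_add i₆ (i₅.const_mul _), integral_add i₁ i₂, integral_const_mul,
    integral_sub i₃ i₄] at ibp
  simp only [weylForm]
  linear_combination ((((2 * Real.pi) ^ (-(d : ℝ)) : ℝ) : ℂ)) * ibp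

/-- Integration of the preceding bound over `p`; this is the start of the induction for the
off-diagonal decay. -/
theorem dominated_weylForm {m σ : ℝ} (hσ : 0 < σ) {b : Rd d × Rd d → ℂ}
    (hb : BoundedByWeight m σ b) :
    Dominated fun g f (p : (Rd d × Rd d) × (Rd d × Rd d)) =>
      theta σ ((1 / 2 : ℝ) • (p.1 + p.2)) ^ (-m)
        * ‖weylForm b (tfShift p.2.1 p.2.2 f) (tfShift p.1.1 p.1.2 g)‖ := by
  obtain ⟨q₁, q₂, h₁, h₂, h⟩ := exists_weylForm_integrand_le hσ hb
  set I := ∫ p : Rd d × Rd d, ((1 + ‖p‖) ^ (2 * d + 1))⁻¹ with hI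
  have hI0 : 0 ≤ I := integral_nonneg fun _ => by positivity
  set c₀ : ℝ := (2 * Real.pi) ^ (-(d : ℝ)) with hc₀
  have hc₀0 : 0 ≤ c₀ := by positivity
  refine (Dominated.const_mul ⟨q₁, q₂, h₁, h₂, fun g f _ => le_rfl⟩
    (mul_nonneg hc₀0 hI0)).mono fun g f ⟨z, w⟩ => ?_
  simp only
  set c := (1 / 2 : ℝ) • (z + w) with hc
  have hθ := ShubinSobolev.theta_pos σ c
  have key : ‖∫ p, b p * conj (crossWigner (tfShift z.1 z.2 g) (tfShift w.1 w.2 f) p)‖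
      ≤ theta σ c ^ m * (q₁ g * q₂ f) * I := by
    have hi : Integrable fun p : Rd d × Rd d => ((1 + ‖p - c‖) ^ (2 * d + 1))⁻¹ :=
      integrable_phase_weight.comp_sub_right c
    rw [hI, ← integral_sub_right_eq_self (fun p : Rd d × Rd d => ((1 + ‖p‖) ^ (2 * d + 1))⁻¹) c,
      ← integral_const_mul]
    exact norm_integral_le_of_norm_le (hi.const_mul _)
      (Filter.Eventually.of_forall fun p => h g f z w p)
  rw [weylForm, norm_mul, Complex.norm_real, Real.norm_of_nonneg hc₀0]
  calc theta σ c ^ (-m) * (c₀ * _)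
      ≤ theta σ c ^ (-m) * (c₀ * (theta σ c ^ m * (q₁ g * q₂ f) * I)) := by gcongr
    _ = (theta σ c ^ (-m) * theta σ c ^ m) * (c₀ * I * (q₁ g * q₂ f)) := by ring
    _ = _ := by
      rw [← Real.rpow_add hθ, neg_add_cancel, Real.rpow_zero, one_mul]

/-- Moving multiplication, or in `derivDir_tfShift` differentiation, past a shift produces a scalar.
The scalars for `z` and `w` differ by a coordinate of `z - w`, the source of the off-diagonal
factor. -/
theorem mulInner_tfShift (v : Rd d) (z : Rd d × Rd d) (f : 𝓢(Rd d, ℂ)) :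
    mulInner v (tfShift z.1 z.2 f)
      = tfShift z.1 z.2 (mulInner v f) + ((inner ℝ z.1 v : ℝ) : ℂ) • tfShift z.1 z.2 f := by
  ext y
  simp only [mulInner_apply, tfShift_apply, add_apply, smul_apply,
    smul_eq_mul, inner_sub_left]
  push_cast
  ring

theorem derivDir_tfShift (v : Rd d) (z : Rd d × Rd d) (f : 𝓢(Rd d, ℂ)) :
    derivDir v (tfShift z.1 z.2 f) = tfShift z.1 z.2 (derivDir v f)
      + (Complex.I * ((inner ℝ z.2 v : ℝ) : ℂ)) • tfShift z.1 z.2 f := by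
  ext y
  have h₁ := hasDerivAt_schwartz_line (tfShift z.1 z.2 f) y v 0
  have h₂ : HasDerivAt (fun t : ℝ => tfShift z.1 z.2 f (y + t • v))
      (Complex.I * (inner ℝ z.2 v : ℝ) * Complex.exp (Complex.I * (inner ℝ y z.2 : ℝ)) * f (y - z.1)
        + Complex.exp (Complex.I * (inner ℝ y z.2 : ℝ)) * derivDir v f (y - z.1)) 0 := by
    have k₁ := hasDerivAt_exp_line (-inner ℝ y z.2) (-inner ℝ v z.2) 0
    have k₂ := hasDerivAt_schwartz_line f (y - z.1) v 0
    have k := k₁.mul k₂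
    have e : (fun t : ℝ => tfShift z.1 z.2 f (y + t • v))
        = (fun t : ℝ => Complex.exp (-(Complex.I * ((-inner ℝ y z.2 + t * -inner ℝ v z.2 : ℝ) : ℂ))))
          * fun t : ℝ => f (y - z.1 + t • v) := by
      ext t
      simp only [tfShift_apply, Pi.mul_apply, inner_add_left, real_inner_smul_left]
      congr 2
      · push_cast
        ring
      · rw [sub_add_eq_add_sub]
    rw [e]
    refine k.congr_deriv ?_
    rw [real_inner_comm v z.2]
    simp
  have h := h₁.unique h₂
  rw [zero_smul, add_zero] at h
  rw [h]
  simp only [tfShift_apply, add_apply, smul_apply, smul_eq_mul]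
  ring

variable {m σ : ℝ} {a : Rd d × Rd d → ℂ}

/-- The matrix form of the commutator identity `[⟨x, v⟩, b^w] = i (∂_ξ b)^w`, with the derivative in
direction `v`. -/
theorem inner_fst_mul_weylForm (hσ : 0 < σ) {b b' : Rd d × Rd d → ℂ}
    (hb : BoundedByWeight m σ b) (hb' : BoundedByWeight m σ b') (v : Rd d)
    (hd : ∀ z, HasLineDerivAt ℝ b (b' z) z (0, v)) (f g : 𝓢(Rd d, ℂ)) (z w : Rd d × Rd d) :
    ((inner ℝ (z - w).1 v : ℝ) : ℂ) * weylForm b (tfShift w.1 w.2 f) (tfShift z.1 z.2 g)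
      = Complex.I * weylForm b' (tfShift w.1 w.2 f) (tfShift z.1 z.2 g)
        + -1 * weylForm b (tfShift w.1 w.2 f) (tfShift z.1 z.2 (mulInner v g))
        + 1 * weylForm b (tfShift w.1 w.2 (mulInner v f)) (tfShift z.1 z.2 g) := by
  have h := weylForm_lineDeriv hσ hb hb' 0 v hd (tfShift w.1 w.2 f) (tfShift z.1 z.2 g)
  have e₀ : ∀ h : 𝓢(Rd d, ℂ), derivDir 0 h = (0 : ℂ) • h := fun h => by
    ext y
    simp [derivDir_apply]
  rw [e₀, e₀, weylForm_smul_left, weylForm_smul_right, mulInner_tfShift, mulInner_tfShift,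
    weylForm_add_left hσ hb, weylForm_add_right hσ hb, weylForm_smul_left, weylForm_smul_right,
    Complex.conj_ofReal] at h
  rw [h, Prod.fst_sub, inner_sub_left]
  push_cast
  simp only [map_zero, zero_mul, add_zero, neg_zero]
  ring_nf
  rw [Complex.I_sq]
  ring

/-- The matrix form of the commutator identity `[∂_v, b^w] = (∂_x b)^w`, with the derivative in
direction `v`. -/
theorem inner_snd_mul_weylForm (hσ : 0 < σ) {b b' : Rd d × Rd d → ℂ}
    (hb : BoundedByWeight m σ b) (hb' : BoundedByWeight m σ b') (v : Rd d)
    (hd : ∀ z, HasLineDerivAt ℝ b (b' z) z (v, 0)) (f g : 𝓢(Rd d, ℂ)) (z w : Rd d × Rd d) :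
    ((inner ℝ (z - w).2 v : ℝ) : ℂ) * weylForm b (tfShift w.1 w.2 f) (tfShift z.1 z.2 g)
      = -Complex.I * weylForm b' (tfShift w.1 w.2 f) (tfShift z.1 z.2 g)
        + -Complex.I * weylForm b (tfShift w.1 w.2 f) (tfShift z.1 z.2 (derivDir v g))
        + -Complex.I * weylForm b (tfShift w.1 w.2 (derivDir v f)) (tfShift z.1 z.2 g) := by
  have h := weylForm_lineDeriv hσ hb hb' v 0 hd (tfShift w.1 w.2 f) (tfShift z.1 z.2 g)
  have e₀ : ∀ h : 𝓢(Rd d, ℂ), mulInner 0 h = (0 : ℂ) • h := fun h => by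
    ext y
    simp [mulInner_apply]
  rw [e₀, e₀, weylForm_smul_left, weylForm_smul_right, derivDir_tfShift, derivDir_tfShift,
    weylForm_add_left hσ hb, weylForm_add_right hσ hb, weylForm_smul_left, weylForm_smul_right,
    map_mul, Complex.conj_ofReal, Complex.conj_I] at h
  rw [h, Prod.snd_sub, inner_sub_left]
  push_cast
  simp only [map_zero, zero_mul]
  ring_nf
  rw [Complex.I_sq]
  ring

/-- Off-diagonal decay of the matrix elements of a Weyl operator. -/
theorem dominated_pow_mul_weylForm (hσ : 0 < σ) (ha : IsSymbol m σ a) (N : ℕ) :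
    Dominated fun g f (p : (Rd d × Rd d) × (Rd d × Rd d)) => (1 + ‖p.1 - p.2‖) ^ N *
      (theta σ ((1 / 2 : ℝ) • (p.1 + p.2)) ^ (-m)
        * ‖weylForm a (tfShift p.2.1 p.2.2 f) (tfShift p.1.1 p.1.2 g)‖) := by
  have hw : ∀ p : (Rd d × Rd d) × (Rd d × Rd d),
      0 ≤ theta σ ((1 / 2 : ℝ) • (p.1 + p.2)) ^ (-m) := fun p =>
    Real.rpow_nonneg (ShubinSobolev.theta_pos σ _).le _
  refine Dominated.one_add_norm_pow (fun g f p => mul_nonneg (hw p) (norm_nonneg _))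
    (fun p => p.1 - p.2) N (dominated_weylForm hσ ha.boundedByWeight) (fun j => ?_) fun j => ?_
  -- Powers of a position coordinate of `z - w` are traded for frequency derivatives of `a`; below,
  -- powers of a frequency coordinate are traded for position derivatives.
  · set v : Rd d := EuclideanSpace.single j (1 : ℝ) with hv
    have := Dominated.pow_mul
      (Φ := fun k g f (p : (Rd d × Rd d) × (Rd d × Rd d)) =>
        weylForm (iterDeriv a (0, v) k) (tfShift p.2.1 p.2.2 f) (tfShift p.1.1 p.1.2 g))
      (w := fun p => theta σ ((1 / 2 : ℝ) • (p.1 + p.2)) ^ (-m)) (ℓ := fun p => (p.1 - p.2).1 j) hw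
      Complex.I (-1) 1 (mulInner v) (mulInner v)
      (fun k => dominated_weylForm hσ (ha.boundedByWeight_snd hσ j k))
      (fun k g f p => by
        have h := inner_fst_mul_weylForm hσ (ha.boundedByWeight_snd hσ j k)
          (ha.boundedByWeight_snd hσ j (k + 1)) v (hasLineDerivAt_iterDeriv ha.1 (0, v) k) f g
          p.1 p.2
        rw [hv, inner_single] at h
        exact h) N 0
    simpa only [iterDeriv_zero] using this
  · set v : Rd d := EuclideanSpace.single j (1 : ℝ) with hv
    have := Dominated.pow_mul
      (Φ := fun k g f (p : (Rd d × Rd d) × (Rd d × Rd d)) =>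
        weylForm (iterDeriv a (v, 0) k) (tfShift p.2.1 p.2.2 f) (tfShift p.1.1 p.1.2 g))
      (w := fun p => theta σ ((1 / 2 : ℝ) • (p.1 + p.2)) ^ (-m)) (ℓ := fun p => (p.1 - p.2).2 j) hw
      (-Complex.I) (-Complex.I) (-Complex.I) (derivDir v) (derivDir v)
      (fun k => dominated_weylForm hσ (ha.boundedByWeight_fst j k))
      (fun k g f p => by
        have h := inner_snd_mul_weylForm hσ (ha.boundedByWeight_fst j k)
          (ha.boundedByWeight_fst j (k + 1)) v (hasLineDerivAt_iterDeriv ha.1 (v, 0) k) f g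
          p.1 p.2
        rw [hv, inner_single] at h
        exact h) N 0
    simpa only [iterDeriv_zero] using this

end WeylForm

/-! ### The short-time Fourier transform of Schwartz functions -/

section Stft

variable {d : ℕ}

theorem continuous_conjS : Continuous (conjS (d := d)) :=
  (SchwartzMap.postcompCLM (E := Rd d) (Complex.conjCLE : ℂ →L[ℝ] ℂ)).continuous

theorem conjS_conjS (f : 𝓢(Rd d, ℂ)) : conjS (conjS f) = f := by
  ext y
  simp [conjS_apply]

theorem conjS_add (f g : 𝓢(Rd d, ℂ)) : conjS (f + g) = conjS f + conjS g := by
  ext y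
  simp [conjS_apply]

theorem conjS_smul (c : ℂ) (f : 𝓢(Rd d, ℂ)) : conjS (c • f) = conj c • conjS f := by
  ext y
  simp [conjS_apply]

/-- Complex conjugation as a conjugate linear map. -/
def conjLM : 𝓢(Rd d, ℂ) →ₗ⋆[ℂ] 𝓢(Rd d, ℂ) where
  toFun := conjS
  map_add' := conjS_add
  map_smul' := conjS_smul

theorem conjS_tfShift (x ξ : Rd d) (f : 𝓢(Rd d, ℂ)) :
    conjS (tfShift x ξ f) = tfShift x (-ξ) (conjS f) := by
  ext y
  rw [conjS_apply, tfShift_apply, tfShift_apply, map_mul, ← Complex.exp_conj, map_mul,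
    Complex.conj_I, Complex.conj_ofReal, inner_neg_right, conjS_apply]
  simp

/-- The pairing `(f, π(w) φ)` of a Schwartz function with a time-frequency shift. -/
def shiftPairing (φ f : 𝓢(Rd d, ℂ)) (w : Rd d × Rd d) : ℂ :=
  ∫ t, f t * conj (tfShift w.1 w.2 φ t)

theorem sesq_toTemperedDistribution (f g : 𝓢(Rd d, ℂ)) :
    sesq (SchwartzMap.toTemperedDistributionCLM (Rd d) ℂ volume f) g = ∫ t, f t * conj (g t) := by
  refine (SchwartzMap.toTemperedDistributionCLM_apply_apply volume f (conjS g)).trans ?_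
  congr 1 with t
  rw [conjS_apply, smul_eq_mul, mul_comm]

theorem continuous_shiftPairing (φ f : 𝓢(Rd d, ℂ)) : Continuous (shiftPairing φ f) := by
  have h : shiftPairing φ f = fun w => SchwartzMap.toTemperedDistributionCLM (Rd d) ℂ volume f
      (conjS (tfShift w.1 w.2 φ)) := by
    ext w
    exact (sesq_toTemperedDistribution f (tfShift w.1 w.2 φ)).symm
  rw [h]
  exact (SchwartzMap.toTemperedDistributionCLM (Rd d) ℂ volume f).continuous.comp
    (continuous_conjS.comp (continuous_tfShift φ))

/-- Reflection at the origin. -/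
def reflect : 𝓢(Rd d, ℂ) →L[ℂ] 𝓢(Rd d, ℂ) :=
  SchwartzMap.compCLMOfContinuousLinearEquiv ℂ (ContinuousLinearEquiv.neg ℝ)

theorem reflect_apply (f : 𝓢(Rd d, ℂ)) (t : Rd d) : reflect f t = f (-t) := rfl

/-- The substitution `t = (y + w.1) / 2` identifies the pairing, up to a phase and the factor `2 ^ d
≥ 1`, with a cross-Wigner distribution with reflected window at `w / 2`, whose decay is known. -/
theorem norm_shiftPairing_le (φ f : 𝓢(Rd d, ℂ)) (w : Rd d × Rd d) :
    ‖shiftPairing φ f w‖ ≤ ‖crossWigner f (reflect φ) ((1 / 2 : ℝ) • w)‖ := by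
  let H : Rd d → ℂ := fun t => f t * conj (φ (t - w.1))
    * Complex.exp (-(Complex.I * (inner ℝ t w.2 : ℝ)))
  have e₁ : shiftPairing φ f w = ∫ t, H t := by
    rw [shiftPairing]
    congr 1 with t
    simp only [H]
    rw [tfShift_apply, map_mul, ← Complex.exp_conj, map_mul, Complex.conj_I, Complex.conj_ofReal,
      neg_mul]
    ring
  have e₂ : ∀ y : Rd d, wignerKernel f (reflect φ) ((1 / 2 : ℝ) • w) y
      = Complex.exp (Complex.I * ((1 / 2 * inner ℝ w.1 w.2 : ℝ) : ℂ))
        * H ((1 / 2 : ℝ) • (y + w.1)) := by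
    intro y
    simp only [wignerKernel, H, reflect_apply, Prod.smul_fst, Prod.smul_snd]
    have k₁ : (1 / 2 : ℝ) • w.1 + (1 / 2 : ℝ) • y = (1 / 2 : ℝ) • (y + w.1) := by module
    have k₂ : -((1 / 2 : ℝ) • w.1 - (1 / 2 : ℝ) • y) = (1 / 2 : ℝ) • (y + w.1) - w.1 := by module
    have k₃ : Complex.exp (-(Complex.I * (inner ℝ y ((1 / 2 : ℝ) • w.2) : ℝ)))
        = Complex.exp (Complex.I * ((1 / 2 * inner ℝ w.1 w.2 : ℝ) : ℂ))
          * Complex.exp (-(Complex.I * (inner ℝ ((1 / 2 : ℝ) • (y + w.1)) w.2 : ℝ))) := by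
      rw [← Complex.exp_add]
      congr 1
      simp only [real_inner_smul_left, real_inner_smul_right, inner_add_left]
      push_cast
      ring
    rw [k₁, k₂, k₃]
    ring
  have e₃ : ∫ y : Rd d, H ((1 / 2 : ℝ) • (y + w.1)) = ((2 ^ d : ℝ) : ℂ) * ∫ t, H t := by
    rw [integral_add_right_eq_self (fun y : Rd d => H ((1 / 2 : ℝ) • y)) w.1,
      Measure.integral_comp_smul]
    simp
  rw [crossWigner_eq]
  simp only [e₂]
  rw [integral_const_mul, norm_mul, norm_exp_I_mul, one_mul, e₃, norm_mul, e₁, Complex.norm_real,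
    Real.norm_of_nonneg (by positivity)]
  exact le_mul_of_one_le_left (norm_nonneg _) (one_le_pow₀ one_le_two)

/-- Rapid decay of the short-time Fourier transform of Schwartz functions. -/
theorem exists_shiftPairing_decay (φ f : 𝓢(Rd d, ℂ)) (N : ℕ) :
    ∃ C : ℝ, ∀ w, (1 + ‖w‖) ^ N * ‖shiftPairing φ f w‖ ≤ C := by
  obtain ⟨q₁, q₂, -, -, h⟩ := dominated_pow_mul_crossWigner (d := d) N
  refine ⟨2 ^ N * (q₁ f * q₂ (reflect φ)), fun w => ?_⟩
  have hw : 1 + ‖w‖ ≤ 2 * (1 + ‖(1 / 2 : ℝ) • w‖) := by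
    rw [norm_smul]
    norm_num
    linarith
  calc (1 + ‖w‖) ^ N * ‖shiftPairing φ f w‖
      ≤ (2 * (1 + ‖(1 / 2 : ℝ) • w‖)) ^ N
        * ‖crossWigner f (reflect φ) ((1 / 2 : ℝ) • w)‖ := by
        gcongr
        exact norm_shiftPairing_le φ f w
    _ = 2 ^ N * ((1 + ‖(1 / 2 : ℝ) • w‖) ^ N
        * ‖crossWigner f (reflect φ) ((1 / 2 : ℝ) • w)‖) := by
        rw [mul_pow, mul_assoc]
    _ ≤ _ := mul_le_mul_of_nonneg_left (h f (reflect φ) _) (by positivity)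

/-- A family of Schwartz functions with polynomially bounded seminorms. -/
def PolyBounded (Ψ : Rd d × Rd d → 𝓢(Rd d, ℂ)) : Prop :=
  ∀ k n, ∃ (N : ℕ) (C : ℝ), ∀ w, SchwartzMap.seminorm ℂ k n (Ψ w) ≤ C * (1 + ‖w‖) ^ N

theorem polyBounded_tfShift (φ : 𝓢(Rd d, ℂ)) : PolyBounded fun w => tfShift w.1 w.2 φ := by
  intro k n
  obtain ⟨N, q, -, h⟩ := exists_seminorm_tfShift_le (d := d) (SchwartzMap.seminorm ℂ k n)
    ((schwartz_withSeminorms ℂ (Rd d) ℂ).continuous_seminorm (k, n))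
  exact ⟨N, q φ, fun w => (h w φ).trans (le_of_eq (mul_comm _ _))⟩

theorem polyBounded_conjS_tfShift (φ : 𝓢(Rd d, ℂ)) :
    PolyBounded fun w => conjS (tfShift w.1 w.2 φ) := by
  intro k n
  obtain ⟨N, C, h⟩ := polyBounded_tfShift (conjS φ) k n
  refine ⟨N, C, fun w => ?_⟩
  have := h (w.1, -w.2)
  simp only [conjS_tfShift]
  have e : ‖((w.1, -w.2) : Rd d × Rd d)‖ = ‖w‖ := by
    simp [Prod.norm_def]
  rwa [e] at this

theorem seminorm_smul_le_of_decay {c : ℂ} {p C M t : ℝ} {N K : ℕ} (ht : 0 ≤ t)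
    (hp : p ≤ C * (1 + t) ^ N) (hC : 0 ≤ C) (hc : (1 + t) ^ (N + K) * ‖c‖ ≤ M) :
    ‖c‖ * p ≤ C * M * ((1 + t) ^ K)⁻¹ := by
  rw [← div_eq_mul_inv, le_div_iff₀ (by positivity)]
  calc ‖c‖ * p * (1 + t) ^ K ≤ ‖c‖ * (C * (1 + t) ^ N) * (1 + t) ^ K := by gcongr
    _ = C * ((1 + t) ^ (N + K) * ‖c‖) := by
      rw [pow_add]
      ring
    _ ≤ C * M := by gcongr

theorem PolyBounded.integrable_seminorm {Ψ : Rd d × Rd d → 𝓢(Rd d, ℂ)} (hΨ : PolyBounded Ψ)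
    (hΨc : Continuous Ψ) {c : Rd d × Rd d → ℂ} (hc : Continuous c)
    (hdec : ∀ N : ℕ, ∃ C : ℝ, ∀ w, (1 + ‖w‖) ^ N * ‖c w‖ ≤ C) (k n : ℕ) :
    Integrable fun w => SchwartzMap.seminorm ℂ k n (c w • Ψ w) := by
  obtain ⟨N, C, hC⟩ := hΨ k n
  obtain ⟨M, hM⟩ := hdec (N + (2 * d + 1))
  have hC0 : 0 ≤ C := by
    have := (apply_nonneg (SchwartzMap.seminorm ℂ k n) (Ψ 0)).trans (hC 0)
    simpa using this
  have hcont : Continuous fun w => SchwartzMap.seminorm ℂ k n (c w • Ψ w) :=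
    ((schwartz_withSeminorms ℂ (Rd d) ℂ).continuous_seminorm (k, n)).comp (hc.smul hΨc)
  refine (integrable_phase_weight.const_mul (C * M)).mono' hcont.aestronglyMeasurable
    (Filter.Eventually.of_forall fun w => ?_)
  rw [Real.norm_of_nonneg (apply_nonneg _ _), map_smul_eq_mul]
  exact seminorm_smul_le_of_decay (norm_nonneg w) (hC w) hC0 (hM w)

/-- The constant of the reconstruction formula. -/
def reconstructionConst (φ : 𝓢(Rd d, ℂ)) : ℂ :=
  (((2 * Real.pi) ^ d : ℝ) : ℂ) * ∫ t, φ t * conj (φ t)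

theorem reconstructionConst_ne_zero {φ : 𝓢(Rd d, ℂ)} (hφ : φ ≠ 0) :
    reconstructionConst φ ≠ 0 := by
  refine mul_ne_zero (by
    rw [Complex.ofReal_ne_zero]
    positivity) fun h => hφ ?_
  have e : ∀ t, φ t * conj (φ t) = ((‖φ t‖ ^ 2 : ℝ) : ℂ) := fun t => by
    rw [Complex.mul_conj, Complex.normSq_eq_norm_sq]
  simp only [e] at h
  rw [integral_complex_ofReal, Complex.ofReal_eq_zero,
    integral_eq_zero_iff_of_nonneg (fun t => by positivity)] at h
  · have hc : Continuous fun t => ‖φ t‖ ^ 2 := φ.continuous.norm.pow 2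
    have := (hc.ae_eq_iff_eq volume continuous_const (g := fun _ => (0 : ℝ))).1 h
    ext t
    have ht := congrFun this t
    simpa using ht
  · have := (φ.memLp 2 volume).integrable_norm_pow (by norm_num)
    simpa using this

open FourierTransform in
/-- The inner integral of the reconstruction formula, by Fourier inversion. -/
theorem integral_shiftPairing_mul_exp (φ f : 𝓢(Rd d, ℂ)) (x y : Rd d) :
    ∫ ξ, shiftPairing φ f (x, ξ) * Complex.exp (Complex.I * (inner ℝ y ξ : ℝ))
      = (((2 * Real.pi) ^ d : ℝ) : ℂ) * (f y * conj (φ (y - x))) := by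
  -- The pairing is the Fourier transform of `h = f · conj φ(· - x)` at `ξ / 2π`; rescaling `ξ` in
  -- the inversion formula produces `(2π) ^ d`.
  let h : 𝓢(Rd d, ℂ) := SchwartzMap.smulLeftCLM ℂ f (conjS (φ.compSubConstCLM ℂ x))
  have hh : ∀ t, h t = f t * conj (φ (t - x)) := fun t => by
    simp only [h]
    rw [SchwartzMap.smulLeftCLM_apply_apply f.hasTemperateGrowth, conjS_apply,
      SchwartzMap.compSubConstCLM_apply, smul_eq_mul]
  have e₁ : ∀ ξ, shiftPairing φ f (x, ξ) = 𝓕 h ((2 * Real.pi)⁻¹ • ξ) := by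
    intro ξ
    rw [SchwartzMap.fourier_coe, Real.fourier_eq', shiftPairing]
    congr 1 with t
    rw [hh, tfShift_apply, map_mul, ← Complex.exp_conj, map_mul, Complex.conj_I,
      Complex.conj_ofReal, smul_eq_mul, inner_smul_right]
    have hpi : -2 * Real.pi * ((2 * Real.pi)⁻¹ * inner ℝ t ξ) = -inner ℝ t ξ := by
      field_simp
    rw [hpi]
    have : ((-inner ℝ t ξ : ℝ) : ℂ) * Complex.I = -Complex.I * (inner ℝ t ξ : ℝ) := by
      push_cast
      ring
    rw [this]
    ring
  have e₂ : ∀ ξ, shiftPairing φ f (x, ξ) * Complex.exp (Complex.I * (inner ℝ y ξ : ℝ))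
      = (fun η => Complex.exp (((2 * Real.pi * inner ℝ η y : ℝ) : ℂ) * Complex.I) • 𝓕 h η)
        ((2 * Real.pi)⁻¹ • ξ) := by
    intro ξ
    simp only
    rw [e₁, real_inner_smul_left, smul_eq_mul, mul_comm]
    congr 2
    have hpi : 2 * Real.pi * ((2 * Real.pi)⁻¹ * inner ℝ ξ y) = inner ℝ ξ y := by
      field_simp
    rw [hpi, real_inner_comm, mul_comm]
  simp only [e₂]
  rw [Measure.integral_comp_inv_smul volume
    (fun η => Complex.exp (((2 * Real.pi * inner ℝ η y : ℝ) : ℂ) * Complex.I) • 𝓕 h η)]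
  have e₃ : ∫ η, Complex.exp (((2 * Real.pi * inner ℝ η y : ℝ) : ℂ) * Complex.I) • 𝓕 h η = h y := by
    rw [← Real.fourierInv_eq', ← SchwartzMap.fourierInv_coe, FourierPair.fourierInv_fourier_eq]
  rw [e₃, hh]
  simp [abs_of_pos Real.pi_pos]

/-- By Fubini the frequency integral is Fourier inversion, and the remaining integral over `x` is `∫
|φ(y - x)|² dx`, independent of `y`. -/
theorem integral_shiftPairing_mul_tfShift (φ f : 𝓢(Rd d, ℂ)) (y : Rd d) :
    ∫ w : Rd d × Rd d, shiftPairing φ f w * tfShift w.1 w.2 φ y = reconstructionConst φ * f y := by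
  have hΦi : Integrable fun w : Rd d × Rd d => shiftPairing φ f w * tfShift w.1 w.2 φ y := by
    have h := (polyBounded_tfShift φ).integrable_seminorm (continuous_tfShift φ)
      (continuous_shiftPairing φ f) (exists_shiftPairing_decay φ f) 0 0
    refine h.mono' ?_ (Filter.Eventually.of_forall fun w => ?_)
    · refine (Continuous.mul (continuous_shiftPairing φ f) ?_).aestronglyMeasurable
      have := φ.continuous
      simp only [tfShift_apply]
      fun_prop
    · exact SchwartzMap.norm_le_seminorm ℂ (shiftPairing φ f w • tfShift w.1 w.2 φ) y
  rw [Measure.volume_eq_prod] at hΦi ⊢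
  rw [integral_prod _ hΦi]
  have e : ∀ x, ∫ ξ, shiftPairing φ f (x, ξ) * tfShift x ξ φ y
      = (((2 * Real.pi) ^ d : ℝ) : ℂ) * f y * (φ (y - x) * conj (φ (y - x))) := by
    intro x
    have := integral_shiftPairing_mul_exp φ f x y
    simp only [tfShift_apply]
    simp only [← mul_assoc]
    rw [integral_mul_const, this]
    ring
  simp only [e]
  rw [integral_const_mul, integral_sub_left_eq_self (fun t => φ t * conj (φ t)) volume y,
    reconstructionConst]
  ring

/-- The reconstruction formula under a continuous linear functional. -/
theorem integral_shiftPairing_mul_apply (φ f : 𝓢(Rd d, ℂ)) (u : 𝓢(Rd d, ℂ) →L[ℂ] ℂ) :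
    ∫ w : Rd d × Rd d, shiftPairing φ f w * u (tfShift w.1 w.2 φ) = reconstructionConst φ * u f := by
  have hc : Continuous fun w : Rd d × Rd d => shiftPairing φ f w • tfShift w.1 w.2 φ :=
    (continuous_shiftPairing φ f).smul (continuous_tfShift φ)
  have hΦi := (polyBounded_tfShift φ).integrable_seminorm (continuous_tfShift φ)
    (continuous_shiftPairing φ f) (exists_shiftPairing_decay φ f)
  have h := apply_schwartzIntegral hc hΦi u
  have e : schwartzIntegral hc hΦi = reconstructionConst φ • f := by
    ext y
    rw [schwartzIntegral_apply]
    exact integral_shiftPairing_mul_tfShift φ f y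
  rw [e, map_smul, smul_eq_mul] at h
  rw [h]
  simp only [map_smul, smul_eq_mul]

end Stft

/-! ### The Weyl operator on tempered distributions -/

section Operator

variable {d : ℕ} {m σ : ℝ} {a : Rd d × Rd d → ℂ}

theorem exists_norm_weylForm_le (hσ : 0 < σ) (ha : BoundedByWeight m σ a) :
    ∃ q₁ q₂ : Seminorm ℂ 𝓢(Rd d, ℂ), Continuous q₁ ∧ Continuous q₂ ∧
      ∀ g f, ‖weylForm a f g‖ ≤ q₁ g * q₂ f := by
  have hθ := ShubinSobolev.theta_pos σ (0 : Rd d × Rd d)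
  obtain ⟨q₁, q₂, h₁, h₂, h⟩ := (dominated_weylForm hσ ha).const_mul
    (Real.rpow_nonneg hθ.le m)
  refine ⟨q₁, q₂, h₁, h₂, fun g f => ?_⟩
  have := h g f (0, 0)
  simp only [add_zero, smul_zero, Prod.fst_zero, Prod.snd_zero, tfShift_zero] at this
  rwa [← mul_assoc, ← Real.rpow_add hθ, add_neg_cancel, Real.rpow_zero, one_mul] at this

theorem continuous_of_norm_le_seminorm (T : 𝓢(Rd d, ℂ) →ₗ[ℂ] ℂ) (q : Seminorm ℂ 𝓢(Rd d, ℂ))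
    (hq : Continuous q) (h : ∀ f, ‖T f‖ ≤ q f) : Continuous T := by
  refine continuous_of_continuousAt_zero T ?_
  rw [ContinuousAt, map_zero]
  refine squeeze_zero_norm h ?_
  simpa using hq.tendsto 0

/-- The functional `f ↦ (a^w(x, D) f, g)`. -/
def weylFunctional (hσ : 0 < σ) (ha : BoundedByWeight m σ a) (g : 𝓢(Rd d, ℂ)) :
    𝓢(Rd d, ℂ) →L[ℂ] ℂ where
  toFun f := weylForm a f g
  map_add' f₁ f₂ := weylForm_add_left hσ ha f₁ f₂ g
  map_smul' c f := weylForm_smul_left a c f g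
  cont := by
    obtain ⟨q₁, q₂, -, h₂, h⟩ := exists_norm_weylForm_le hσ ha
    let T : 𝓢(Rd d, ℂ) →ₗ[ℂ] ℂ :=
      { toFun := fun f => weylForm a f g
        map_add' := fun f₁ f₂ => weylForm_add_left hσ ha f₁ f₂ g
        map_smul' := fun c f => weylForm_smul_left a c f g }
    let r : NNReal := ⟨q₁ g, apply_nonneg _ _⟩
    exact continuous_of_norm_le_seminorm T (r • q₂) (h₂.const_smul r) fun f => h g f

/-- Rapid decay of `w ↦ (a^w(x, D) π(w) φ, g)` for Schwartz functions `g`. -/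
theorem exists_weylForm_tfShift_decay (hσ : 0 < σ) (ha : IsSymbol m σ a) (φ : 𝓢(Rd d, ℂ)) (N : ℕ) :
    ∃ q : Seminorm ℂ 𝓢(Rd d, ℂ), Continuous q ∧ ∀ g (w : Rd d × Rd d),
      (1 + ‖w‖) ^ N * ‖weylForm a (tfShift w.1 w.2 φ) g‖ ≤ q g := by
  obtain ⟨C, L, hC, hθ⟩ := exists_theta_add_rpow_le (d := d) hσ m
  -- The off-diagonal bound is used at `z = 0`; `L` extra powers compare the weight at the midpoint
  -- `w / 2` with the weight at the origin.
  obtain ⟨q₁, q₂, h₁, -, h⟩ := dominated_pow_mul_weylForm hσ ha (N + L)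
  have hθ0 : 0 < theta σ (0 : Rd d × Rd d) ^ m :=
    Real.rpow_pos_of_pos (ShubinSobolev.theta_pos σ _) _
  let c : NNReal := ⟨C * theta σ (0 : Rd d × Rd d) ^ m * q₂ φ, by positivity⟩
  refine ⟨c • q₁, h₁.const_smul c, fun g w => ?_⟩
  have key := h g φ (0, w)
  simp only [zero_sub, norm_neg, zero_add, Prod.fst_zero, Prod.snd_zero, tfShift_zero] at key
  set c' := (1 / 2 : ℝ) • w with hc'
  have hθc := ShubinSobolev.theta_pos σ c'
  have hcw : ‖c'‖ ≤ ‖w‖ := by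
    rw [hc', norm_smul]
    norm_num
    linarith [norm_nonneg w]
  have e : theta σ c' ^ m ≤ C * (1 + ‖w‖) ^ L * theta σ (0 : Rd d × Rd d) ^ m := by
    have := hθ 0 c'
    rw [zero_add] at this
    refine this.trans ?_
    gcongr
  set X := ‖weylForm a (tfShift w.1 w.2 φ) g‖
  change _ ≤ C * theta σ (0 : Rd d × Rd d) ^ m * q₂ φ * q₁ g
  calc (1 + ‖w‖) ^ N * X
      = theta σ c' ^ m * ((1 + ‖w‖) ^ N * (theta σ c' ^ (-m) * X)) := by
        rw [mul_left_comm (theta σ c' ^ m), ← mul_assoc (theta σ c' ^ m), ← Real.rpow_add hθc,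
          add_neg_cancel, Real.rpow_zero, one_mul]
    _ ≤ (C * (1 + ‖w‖) ^ L * theta σ (0 : Rd d × Rd d) ^ m)
        * ((1 + ‖w‖) ^ N * (theta σ c' ^ (-m) * X)) := by
        gcongr
    _ = C * theta σ (0 : Rd d × Rd d) ^ m * ((1 + ‖w‖) ^ (N + L) * (theta σ c' ^ (-m) * X)) := by
        rw [pow_add]
        ring
    _ ≤ C * theta σ (0 : Rd d × Rd d) ^ m * (q₁ g * q₂ φ) :=
        mul_le_mul_of_nonneg_left key (by positivity)
    _ = _ := by ring

theorem continuous_weylForm_tfShift (hσ : 0 < σ) (ha : BoundedByWeight m σ a) (φ g : 𝓢(Rd d, ℂ)) :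
    Continuous fun w : Rd d × Rd d => weylForm a (tfShift w.1 w.2 φ) g :=
  (weylFunctional hσ ha g).continuous.comp (continuous_tfShift φ)

theorem continuous_of_seminorm_le (T : 𝓢(Rd d, ℂ) →ₗ[ℂ] 𝓢(Rd d, ℂ))
    (h : ∀ k n, ∃ q : Seminorm ℂ 𝓢(Rd d, ℂ), Continuous q ∧
      ∀ f, SchwartzMap.seminorm ℂ k n (T f) ≤ q f) : Continuous T := by
  refine continuous_of_continuousAt_zero T ?_
  rw [ContinuousAt, map_zero, (schwartz_withSeminorms ℂ (Rd d) ℂ).tendsto_nhds]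
  intro i ε hε
  obtain ⟨q, hq, hqT⟩ := h i.1 i.2
  have ht : Filter.Tendsto q (nhds 0) (nhds 0) := by simpa using hq.tendsto 0
  filter_upwards [ht.eventually_lt_const hε] with f hf
  rw [sub_zero]
  exact (hqT f).trans_lt hf

/-- The transpose of the Weyl operator acting on Schwartz functions, up to a constant. -/
theorem exists_weylTranspose (hσ : 0 < σ) (ha : IsSymbol m σ a) (φ : 𝓢(Rd d, ℂ)) :
    ∃ B : 𝓢(Rd d, ℂ) →L[ℂ] 𝓢(Rd d, ℂ), ∀ (u : 𝓢(Rd d, ℂ) →L[ℂ] ℂ) f,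
      u (B f) = ∫ w : Rd d × Rd d,
        weylForm a (tfShift w.1 w.2 φ) (conjS f) * u (conjS (tfShift w.1 w.2 φ)) := by
  have ha₀ := ha.boundedByWeight
  let Ψ : Rd d × Rd d → 𝓢(Rd d, ℂ) := fun w => conjS (tfShift w.1 w.2 φ)
  have hΨ : PolyBounded Ψ := polyBounded_conjS_tfShift φ
  have hΨc : Continuous Ψ := continuous_conjS.comp (continuous_tfShift φ)
  -- The Weyl form is conjugate linear in its second argument; conjugating `f` makes the coefficient
  -- linear in `f`.
  let c : 𝓢(Rd d, ℂ) → Rd d × Rd d → ℂ := fun f w => weylForm a (tfShift w.1 w.2 φ) (conjS f)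
  have hc : ∀ f, Continuous (c f) := fun f => continuous_weylForm_tfShift hσ ha₀ φ (conjS f)
  have hdec : ∀ f (N : ℕ), ∃ C : ℝ, ∀ w, (1 + ‖w‖) ^ N * ‖c f w‖ ≤ C := by
    intro f N
    obtain ⟨q, -, h⟩ := exists_weylForm_tfShift_decay hσ ha φ N
    exact ⟨_, fun w => h (conjS f) w⟩
  have hΦ : ∀ f, Continuous fun w => c f w • Ψ w := fun f => (hc f).smul hΨc
  have hΦi := fun f => hΨ.integrable_seminorm hΨc (hc f) (hdec f)
  have hpt : ∀ f y, Integrable fun w => c f w * Ψ w y := by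
    intro f y
    refine (hΦi f 0 0).mono' ?_ (Filter.Eventually.of_forall fun w => ?_)
    · refine (Continuous.mul (hc f) ?_).aestronglyMeasurable
      have := φ.continuous
      simp only [Ψ, conjS_apply, tfShift_apply]
      fun_prop
    · exact SchwartzMap.norm_le_seminorm ℂ (c f w • Ψ w) y
  let T : 𝓢(Rd d, ℂ) →ₗ[ℂ] 𝓢(Rd d, ℂ) :=
    { toFun := fun f => schwartzIntegral (hΦ f) (hΦi f)
      map_add' := fun f g => by
        ext y
        rw [add_apply, schwartzIntegral_apply, schwartzIntegral_apply, schwartzIntegral_apply]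
        simp only [smul_apply, smul_eq_mul]
        rw [← integral_add (hpt f y) (hpt g y)]
        congr 1 with w
        simp only [c]
        rw [conjS_add, weylForm_add_right hσ ha₀, add_mul]
      map_smul' := fun r f => by
        ext y
        rw [smul_apply, schwartzIntegral_apply, schwartzIntegral_apply]
        simp only [smul_apply, smul_eq_mul, RingHom.id_apply]
        rw [← integral_const_mul]
        congr 1 with w
        simp only [c]
        rw [conjS_smul, weylForm_smul_right, Complex.conj_conj, mul_assoc] }
  have hT : Continuous T := by
    refine continuous_of_seminorm_le T fun k n => ?_
    obtain ⟨N, C, hC⟩ := hΨ k n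
    have hC0 : 0 ≤ C := by
      have := (apply_nonneg (SchwartzMap.seminorm ℂ k n) (Ψ 0)).trans (hC 0)
      simpa using this
    -- `N` powers absorb the growth of the seminorms of `Ψ w`, and `2 * d + 1` powers make the
    -- integral converge.
    obtain ⟨q, hq, hqd⟩ := exists_weylForm_tfShift_decay hσ ha φ (N + (2 * d + 1))
    set I := ∫ p : Rd d × Rd d, ((1 + ‖p‖) ^ (2 * d + 1))⁻¹ with hI
    have hI0 : 0 ≤ I := integral_nonneg fun _ => by positivity
    let r : NNReal := ⟨C * I, by positivity⟩
    refine ⟨r • q.comp conjLM, ((hq.comp continuous_conjS).const_smul r), fun f => ?_⟩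
    refine (seminorm_schwartzIntegral_le (hΦ f) (hΦi f) k n).trans ?_
    change _ ≤ C * I * q (conjS f)
    have e : C * I * q (conjS f)
        = ∫ p : Rd d × Rd d, C * q (conjS f) * ((1 + ‖p‖) ^ (2 * d + 1))⁻¹ := by
      rw [integral_const_mul]
      ring
    rw [e]
    refine integral_mono (hΦi f k n) (integrable_phase_weight.const_mul _) fun w => ?_
    simp only [map_smul_eq_mul]
    exact seminorm_smul_le_of_decay (norm_nonneg w) (hC w) hC0 (hqd (conjS f) w)
  refine ⟨⟨T, hT⟩, fun u f => ?_⟩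
  have h := apply_schwartzIntegral (hΦ f) (hΦi f) u
  simp only [map_smul, smul_eq_mul] at h
  exact h

/-- Every weak-* continuous linear functional on tempered distributions is an evaluation. -/
theorem exists_eq_apply (ℓ : 𝓢'(Rd d, ℂ) →L[ℂ] ℂ) : ∃ h : 𝓢(Rd d, ℂ), ∀ u, ℓ u = u h := by
  let e := PointwiseConvergenceCLM.equivWeakDual ℂ 𝓢(Rd d, ℂ)
  obtain ⟨h, hh⟩ := LinearMap.dualEmbedding_surjective (topDualPairing ℂ 𝓢(Rd d, ℂ))
    (ℓ.comp e.symm.toContinuousLinearMap)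
  refine ⟨h, fun u => ?_⟩
  have := DFunLike.congr_fun hh (e u)
  exact this.symm

/-- For fixed `f`, the map `u ↦ (A₁ u - A₂ u) f` is weak-* continuous, hence evaluation at some
Schwartz function `h`. It vanishes on the distribution defined by `conj h`, where its value is `∫
|h|²`, so `h = 0`. -/
theorem IsWeylOperator.unique {A₁ A₂ : 𝓢'(Rd d, ℂ) →L[ℂ] 𝓢'(Rd d, ℂ)} (h₁ : IsWeylOperator a A₁)
    (h₂ : IsWeylOperator a A₂) : A₁ = A₂ := by
  ext u f
  obtain ⟨h, hh⟩ := exists_eq_apply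
    ((PointwiseConvergenceCLM.evalCLM (RingHom.id ℂ) ℂ f).comp (A₁ - A₂))
  have hval : ∀ u, A₁ u f - A₂ u f = u h := fun u => hh u
  have h0 : h = 0 := by
    -- Here `reconstructionConst h` serves only as a nonzero multiple of `∫ |h|²`.
    by_contra hne
    refine reconstructionConst_ne_zero hne ?_
    have e := hval (SchwartzMap.toTemperedDistributionCLM (Rd d) ℂ volume (conjS h))
    have e₁ := h₁ (conjS h) (conjS f)
    have e₂ := h₂ (conjS h) (conjS f)
    rw [← e₂, sesq, sesq, conjS_conjS] at e₁
    rw [e₁, sub_self] at e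
    have e₃ := sesq_toTemperedDistribution (conjS h) (conjS h)
    rw [sesq, conjS_conjS, ← e] at e₃
    rw [reconstructionConst]
    have e₄ : ∫ t, h t * conj (h t) = ∫ t, conjS h t * conj (conjS h t) := by
      congr 1 with t
      rw [conjS_apply, Complex.conj_conj, mul_comm]
    rw [e₄, ← e₃, mul_zero]
  have := hval u
  rw [h0, map_zero] at this
  exact sub_eq_zero.1 this

/-- Existence of the Weyl operator, with a formula for its matrix elements in terms of
time-frequency shifts of a window. -/
theorem exists_isWeylOperator (hσ : 0 < σ) (ha : IsSymbol m σ a) {φ : 𝓢(Rd d, ℂ)} (hφ : φ ≠ 0) :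
    ∃ A : 𝓢'(Rd d, ℂ) →L[ℂ] 𝓢'(Rd d, ℂ), IsWeylOperator a A ∧ ∀ u g, sesq (A u) g
      = (reconstructionConst φ)⁻¹ * ∫ w : Rd d × Rd d,
        weylForm a (tfShift w.1 w.2 φ) g * sesq u (tfShift w.1 w.2 φ) := by
  obtain ⟨B, hB⟩ := exists_weylTranspose hσ ha φ
  let A : 𝓢'(Rd d, ℂ) →L[ℂ] 𝓢'(Rd d, ℂ) :=
    (reconstructionConst φ)⁻¹ • PointwiseConvergenceCLM.precomp ℂ B
  have hA : ∀ u g, sesq (A u) g = (reconstructionConst φ)⁻¹ * ∫ w : Rd d × Rd d,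
      weylForm a (tfShift w.1 w.2 φ) g * sesq u (tfShift w.1 w.2 φ) := by
    intro u g
    have h : sesq (A u) g = (reconstructionConst φ)⁻¹ * u (B (conjS g)) := rfl
    have h' := hB u (conjS g)
    rw [h]
    congr 1
    refine h'.trans ?_
    rw [conjS_conjS]
    rfl
  refine ⟨A, fun f g => ?_, hA⟩
  rw [hA]
  -- On Schwartz functions the matrix formula is the reconstruction formula seen by the continuous
  -- functional `f ↦ (a^w f, g)`.
  have hrec := integral_shiftPairing_mul_apply φ f (weylFunctional hσ ha.boundedByWeight g)
  have e : ∀ w : Rd d × Rd d, weylForm a (tfShift w.1 w.2 φ) g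
      * sesq (SchwartzMap.toTemperedDistributionCLM (Rd d) ℂ volume f) (tfShift w.1 w.2 φ)
      = shiftPairing φ f w * weylFunctional hσ ha.boundedByWeight g (tfShift w.1 w.2 φ) := by
    intro w
    rw [sesq_toTemperedDistribution, mul_comm]
    rfl
  simp only [e]
  rw [hrec, inv_mul_cancel_left₀ (reconstructionConst_ne_zero hφ)]
  rfl

end Operator

/-! ### Boundedness on the Shubin–Sobolev spaces -/

section Schur

open scoped ENNReal

/-- Cauchy–Schwarz for the factorization `k f = k^{1/2} · (k^{1/2} f)`. -/
theorem lintegral_mul_sq_le {X : Type*} [MeasurableSpace X] (μ : Measure X) {k f : X → ℝ≥0∞}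
    (hk : AEMeasurable k μ) (hf : AEMeasurable f μ) :
    (∫⁻ x, k x * f x ∂μ) ^ (2 : ℝ) ≤ (∫⁻ x, k x ∂μ) * ∫⁻ x, k x * f x ^ (2 : ℝ) ∂μ := by
  have h := ENNReal.lintegral_mul_le_Lp_mul_Lq μ Real.HolderConjugate.two_two
    (hk.pow_const (1 / 2 : ℝ)) ((hk.pow_const (1 / 2 : ℝ)).mul hf)
  have half : ∀ t : ℝ≥0∞, (t ^ (1 / 2 : ℝ)) ^ (2 : ℝ) = t := fun t => by
    rw [← ENNReal.rpow_mul]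
    norm_num
  have e₁ : ∀ x, ((fun x => k x ^ (1 / 2 : ℝ)) * ((fun x => k x ^ (1 / 2 : ℝ)) * f)) x
      = k x * f x := fun x => by
    simp only [Pi.mul_apply]
    rw [← mul_assoc, ← ENNReal.rpow_add_of_nonneg _ _ (by norm_num) (by norm_num)]
    norm_num
  have e₂ : ∀ x, ((fun x => k x ^ (1 / 2 : ℝ)) * f) x ^ (2 : ℝ) = k x * f x ^ (2 : ℝ) := fun x => by
    simp only [Pi.mul_apply]
    rw [ENNReal.mul_rpow_of_nonneg _ _ (by norm_num), half]
  simp only [e₁, e₂, half] at h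
  calc (∫⁻ x, k x * f x ∂μ) ^ (2 : ℝ)
      ≤ ((∫⁻ x, k x ∂μ) ^ (1 / 2 : ℝ) * (∫⁻ x, k x * f x ^ (2 : ℝ) ∂μ) ^ (1 / 2 : ℝ)) ^ (2 : ℝ) :=
        ENNReal.rpow_le_rpow h (by norm_num)
    _ = _ := by
        rw [ENNReal.mul_rpow_of_nonneg _ _ (by norm_num), half, half]

/-- Young's inequality for the convolution of an integrable and a square integrable function. -/
theorem lintegral_convolution_sq_le {X : Type*} [NormedAddCommGroup X] [MeasurableSpace X]
    [BorelSpace X] [SecondCountableTopology X] (μ : Measure X) [SFinite μ] [μ.IsAddLeftInvariant]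
    [μ.IsNegInvariant] {k f : X → ℝ≥0∞} (hk : Measurable k) (hf : Measurable f) :
    ∫⁻ z, (∫⁻ w, k (z - w) * f w ∂μ) ^ (2 : ℝ) ∂μ
      ≤ (∫⁻ x, k x ∂μ) ^ (2 : ℝ) * ∫⁻ w, f w ^ (2 : ℝ) ∂μ := by
  have hkz : ∀ z, Measurable fun w => k (z - w) := fun z => hk.comp (measurable_const.sub measurable_id)
  have hkw : ∀ w, Measurable fun z => k (z - w) := fun w => hk.comp (measurable_id.sub measurable_const)
  calc ∫⁻ z, (∫⁻ w, k (z - w) * f w ∂μ) ^ (2 : ℝ) ∂μ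
      ≤ ∫⁻ z, (∫⁻ x, k x ∂μ) * ∫⁻ w, k (z - w) * f w ^ (2 : ℝ) ∂μ ∂μ := by
        refine lintegral_mono fun z => ?_
        refine (lintegral_mul_sq_le μ (hkz z).aemeasurable hf.aemeasurable).trans (le_of_eq ?_)
        rw [lintegral_sub_left_eq_self k z]
    _ = (∫⁻ x, k x ∂μ) * ∫⁻ z, ∫⁻ w, k (z - w) * f w ^ (2 : ℝ) ∂μ ∂μ := by
        refine lintegral_const_mul _ ?_
        refine Measurable.lintegral_prod_right' (f := fun p : X × X => k (p.1 - p.2) * f p.2 ^ (2 : ℝ)) ?_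
        exact (hk.comp (measurable_fst.sub measurable_snd)).mul
          ((hf.comp measurable_snd).pow_const _)
    _ = (∫⁻ x, k x ∂μ) * ∫⁻ w, ∫⁻ z, k (z - w) * f w ^ (2 : ℝ) ∂μ ∂μ := by
        rw [lintegral_lintegral_swap]
        exact ((hk.comp (measurable_fst.sub measurable_snd)).mul
          ((hf.comp measurable_snd).pow_const _)).aemeasurable
    _ = (∫⁻ x, k x ∂μ) * ∫⁻ w, (∫⁻ x, k x ∂μ) * f w ^ (2 : ℝ) ∂μ := by
        congr 1
        refine lintegral_congr fun w => ?_
        rw [lintegral_mul_const _ (hkw w), lintegral_sub_right_eq_self k w]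
    _ = _ := by
        rw [lintegral_const_mul _ (hf.pow_const _), ← mul_assoc, ENNReal.rpow_two, sq]

variable {d : ℕ} {m s σ : ℝ} {a : Rd d × Rd d → ℂ}

theorem continuous_weightedStft (hσ : 0 < σ) (s : ℝ) (φ : 𝓢(Rd d, ℂ)) (u : 𝓢'(Rd d, ℂ)) :
    Continuous (weightedStft σ s φ u) := by
  have h : Continuous fun z : Rd d × Rd d => sesq u (tfShift z.1 z.2 φ) :=
    u.continuous.comp (continuous_conjS.comp (continuous_tfShift φ))
  exact (Complex.continuous_ofReal.comp (continuous_theta_rpow hσ s)).mul (continuous_const.mul h)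

/-- The weighted matrix elements of a Weyl operator are dominated by a convolution kernel. -/
theorem exists_weighted_weylForm_le (hσ : 0 < σ) (ha : IsSymbol m σ a) (s : ℝ) (φ : 𝓢(Rd d, ℂ)) :
    ∃ C : ℝ, 0 ≤ C ∧ ∀ z w : Rd d × Rd d,
      theta σ z ^ s * ‖weylForm a (tfShift w.1 w.2 φ) (tfShift z.1 z.2 φ)‖
        ≤ C * ((1 + ‖z - w‖) ^ (2 * d + 1))⁻¹ * theta σ w ^ (s + m) := by
  obtain ⟨C₁, L₁, hC₁, h₁⟩ := exists_theta_add_rpow_le (d := d) hσ s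
  obtain ⟨C₂, L₂, hC₂, h₂⟩ := exists_theta_add_rpow_le (d := d) hσ m
  -- `L₁` powers move `θ_σ ^ s` from `z` to `w`, `L₂` powers move `θ_σ ^ m` from the midpoint to
  -- `w`, and `2 * d + 1` remain for integrability on `ℝ²ᵈ`.
  obtain ⟨q₁, q₂, -, -, h⟩ := dominated_pow_mul_weylForm hσ ha (L₁ + L₂ + (2 * d + 1))
  have hq : 0 ≤ q₁ φ * q₂ φ := mul_nonneg (apply_nonneg _ _) (apply_nonneg _ _)
  refine ⟨C₁ * C₂ * (q₁ φ * q₂ φ), by positivity, fun z w => ?_⟩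
  have key := h φ φ (z, w)
  simp only at key
  set c := (1 / 2 : ℝ) • (z + w) with hc
  set R := 1 + ‖z - w‖ with hR
  set K := ‖weylForm a (tfShift w.1 w.2 φ) (tfShift z.1 z.2 φ)‖ with hK
  have hR0 : 0 < R := by positivity
  have hθc := ShubinSobolev.theta_pos σ c
  have hθw := ShubinSobolev.theta_pos σ w
  have e₁ : theta σ z ^ s ≤ C₁ * R ^ L₁ * theta σ w ^ s := by
    simpa using h₁ w (z - w)
  have e₂ : theta σ c ^ m ≤ C₂ * R ^ L₂ * theta σ w ^ m := by
    have hcw : c = w + (1 / 2 : ℝ) • (z - w) := by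
      rw [hc]
      module
    have hn : ‖(1 / 2 : ℝ) • (z - w)‖ ≤ ‖z - w‖ := by
      rw [norm_smul]
      norm_num
      linarith [norm_nonneg (z - w)]
    have := h₂ w ((1 / 2 : ℝ) • (z - w))
    rw [← hcw] at this
    refine this.trans ?_
    gcongr
    exact add_le_add_right hn 1
  have e₃ : K = theta σ c ^ m * (theta σ c ^ (-m) * K) := by
    rw [← mul_assoc, ← Real.rpow_add hθc, add_neg_cancel, Real.rpow_zero, one_mul]
  have hX : 0 ≤ theta σ c ^ (-m) * K := by positivity
  rw [mul_right_comm, ← div_eq_mul_inv, le_div_iff₀ (by positivity), Real.rpow_add hθw]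
  calc theta σ z ^ s * K * R ^ (2 * d + 1)
      = theta σ z ^ s * (theta σ c ^ m * (theta σ c ^ (-m) * K)) * R ^ (2 * d + 1) := by rw [← e₃]
    _ ≤ (C₁ * R ^ L₁ * theta σ w ^ s) * ((C₂ * R ^ L₂ * theta σ w ^ m) * (theta σ c ^ (-m) * K))
        * R ^ (2 * d + 1) := by gcongr
    _ = C₁ * C₂ * (theta σ w ^ s * theta σ w ^ m)
        * (R ^ (L₁ + L₂ + (2 * d + 1)) * (theta σ c ^ (-m) * K)) := by
        rw [pow_add, pow_add]
        ring
    _ ≤ C₁ * C₂ * (theta σ w ^ s * theta σ w ^ m) * (q₁ φ * q₂ φ) :=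
        mul_le_mul_of_nonneg_left key (by positivity)
    _ = _ := by ring

/-- Boundedness of the Weyl operator between weighted `L²` spaces on the side of the short-time
Fourier transform. -/
theorem exists_eLpNorm_weightedStft_le (hσ : 0 < σ) (ha : IsSymbol m σ a) (s : ℝ)
    {φ : 𝓢(Rd d, ℂ)} (hφ : φ ≠ 0) {A : 𝓢'(Rd d, ℂ) →L[ℂ] 𝓢'(Rd d, ℂ)} (hA : IsWeylOperator a A) :
    ∃ C : NNReal, ∀ u, eLpNorm (weightedStft σ s φ (A u)) 2 volume
      ≤ C * eLpNorm (weightedStft σ (s + m) φ u) 2 volume := by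
  -- By uniqueness `A` is the operator constructed with window `φ`, so its matrix formula is
  -- available.
  obtain ⟨A', hA', hform⟩ := exists_isWeylOperator hσ ha hφ
  obtain rfl := hA.unique hA'
  obtain ⟨C, hC, hK⟩ := exists_weighted_weylForm_le hσ ha s φ
  let κ : ℝ := ‖(reconstructionConst φ)⁻¹‖ * C
  have hκ : 0 ≤ κ := by positivity
  let k : Rd d × Rd d → ℝ := fun p => κ * ((1 + ‖p‖) ^ (2 * d + 1))⁻¹
  have hk0 : ∀ p, 0 ≤ k p := fun p => by positivity
  have hkc : Continuous k := by
    refine continuous_const.mul (Continuous.inv₀ (by fun_prop) fun p => by positivity)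
  have hkint : Integrable k := integrable_phase_weight.const_mul κ
  let kE : Rd d × Rd d → ℝ≥0∞ := fun p => ENNReal.ofReal (k p)
  have hkE : Measurable kE := hkc.measurable.ennreal_ofReal
  have hkE_fin : ∫⁻ p, kE p ≠ ⊤ := by
    rw [← ofReal_integral_eq_lintegral_ofReal hkint (Filter.Eventually.of_forall hk0)]
    exact ENNReal.ofReal_ne_top
  -- The operator bound is the `L¹` norm of the convolution kernel, as in Young's inequality.
  refine ⟨(∫⁻ p, kE p).toNNReal, fun u => ?_⟩
  rw [ENNReal.coe_toNNReal hkE_fin]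
  set F := weightedStft σ (s + m) φ u with hF
  have hFm : Measurable fun w => ‖F w‖ₑ := (continuous_weightedStft hσ _ φ u).measurable.enorm
  have hpt : ∀ z, ‖weightedStft σ s φ (A u) z‖ₑ ≤ ∫⁻ w, kE (z - w) * ‖F w‖ₑ := by
    intro z
    -- The factor `(2π)^(-d/2)` in the transform of `A u` becomes the one in the transform of `u`,
    -- so it does not enter the kernel.
    have e₁ : weightedStft σ s φ (A u) z = ∫ w : Rd d × Rd d, ((theta σ z ^ s : ℝ) : ℂ)
        * ((reconstructionConst φ)⁻¹ * (weylForm a (tfShift w.1 w.2 φ) (tfShift z.1 z.2 φ)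
          * stft φ u w)) := by
      rw [weightedStft, stft, hform, integral_const_mul, integral_const_mul]
      simp only [stft, mul_left_comm (weylForm _ _ _)]
      rw [integral_const_mul]
      ring
    rw [e₁]
    refine (enorm_integral_le_lintegral_enorm _).trans (lintegral_mono fun w => ?_)
    have hθw := ShubinSobolev.theta_pos σ w
    have hle : ‖((theta σ z ^ s : ℝ) : ℂ)
        * ((reconstructionConst φ)⁻¹ * (weylForm a (tfShift w.1 w.2 φ) (tfShift z.1 z.2 φ)
          * stft φ u w))‖ ≤ k (z - w) * ‖F w‖ := by
      have hθz := ShubinSobolev.theta_pos σ z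
      rw [hF, weightedStft, norm_mul, norm_mul, norm_mul, norm_mul, Complex.norm_real,
        Complex.norm_real, Real.norm_of_nonneg (Real.rpow_nonneg hθz.le _),
        Real.norm_of_nonneg (Real.rpow_nonneg hθw.le _)]
      calc _ = ‖(reconstructionConst φ)⁻¹‖ * (theta σ z ^ s
            * ‖weylForm a (tfShift w.1 w.2 φ) (tfShift z.1 z.2 φ)‖) * ‖stft φ u w‖ := by ring
        _ ≤ ‖(reconstructionConst φ)⁻¹‖ * (C * ((1 + ‖z - w‖) ^ (2 * d + 1))⁻¹
            * theta σ w ^ (s + m)) * ‖stft φ u w‖ := by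
            exact mul_le_mul_of_nonneg_right
              (mul_le_mul_of_nonneg_left (hK z w) (norm_nonneg _)) (norm_nonneg _)
        _ = _ := by
            simp only [k, κ]
            ring
    rw [← ofReal_norm, ← ofReal_norm]
    simp only [kE]
    rw [← ENNReal.ofReal_mul (hk0 _)]
    exact ENNReal.ofReal_le_ofReal hle
  rw [eLpNorm_eq_lintegral_rpow_enorm_toReal (by norm_num) (by norm_num),
    eLpNorm_eq_lintegral_rpow_enorm_toReal (by norm_num) (by norm_num), ENNReal.toReal_ofNat]
  have : (volume : Measure (Rd d × Rd d)).IsAddHaarMeasure :=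
    inferInstanceAs (Measure.prod volume volume).IsAddHaarMeasure
  have : (volume : Measure (Rd d × Rd d)).IsNegInvariant :=
    Measure.IsAddHaarMeasure.isNegInvariant_of_regular _
  have hsq : ∫⁻ z, ‖weightedStft σ s φ (A u) z‖ₑ ^ (2 : ℝ)
      ≤ (∫⁻ p, kE p) ^ (2 : ℝ) * ∫⁻ w, ‖F w‖ₑ ^ (2 : ℝ) :=
    (lintegral_mono fun z => ENNReal.rpow_le_rpow (hpt z) (by norm_num)).trans
      (lintegral_convolution_sq_le volume hkE hFm)
  calc (∫⁻ z, ‖weightedStft σ s φ (A u) z‖ₑ ^ (2 : ℝ)) ^ (1 / (2 : ℝ))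
      ≤ ((∫⁻ p, kE p) ^ (2 : ℝ) * ∫⁻ w, ‖F w‖ₑ ^ (2 : ℝ)) ^ (1 / (2 : ℝ)) :=
        ENNReal.rpow_le_rpow hsq (by norm_num)
    _ = _ := by
        rw [ENNReal.mul_rpow_of_nonneg _ _ (by norm_num), ← ENNReal.rpow_mul]
        norm_num

theorem ShubinSobolev.norm_eq_toReal_eLpNorm {φ : 𝓢(Rd d, ℂ)} (u : ShubinSobolev σ s φ) :
    ‖u‖ = (eLpNorm (weightedStft σ s φ (incl u)) 2 volume).toReal :=
  Lp.norm_toLp _ (memLp_weightedStft u)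

/-- A Weyl operator restricts to the Shubin–Sobolev spaces. -/
theorem IsWeylOperator.exists_restriction (hσ : 0 < σ) (ha : IsSymbol m σ a) (s : ℝ)
    {φ : 𝓢(Rd d, ℂ)} (hφ : φ ≠ 0) {A : 𝓢'(Rd d, ℂ) →L[ℂ] 𝓢'(Rd d, ℂ)} (hA : IsWeylOperator a A) :
    ∃ T : ShubinSobolev σ (s + m) φ →L[ℂ] ShubinSobolev σ s φ, ∀ u, (T u).incl = A u.incl := by
  obtain ⟨C, hC⟩ := exists_eLpNorm_weightedStft_le hσ ha s hφ hA
  have hfin : ∀ u : ShubinSobolev σ (s + m) φ,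
      C * eLpNorm (weightedStft σ (s + m) φ u.incl) 2 volume < ⊤ := fun u =>
    ENNReal.mul_lt_top ENNReal.coe_lt_top u.memLp_weightedStft.2
  have hmem : ∀ u : ShubinSobolev σ (s + m) φ, A u.incl ∈ sobolevSubmodule σ s φ := fun u =>
    ⟨(continuous_weightedStft hσ s φ (A u.incl)).aestronglyMeasurable,
      (hC u.incl).trans_lt (hfin u)⟩
  let T₀ : ShubinSobolev σ (s + m) φ →ₗ[ℂ] ShubinSobolev σ s φ :=
    LinearMap.codRestrict (sobolevSubmodule σ s φ) (A.toLinearMap ∘ₗ ShubinSobolev.incl) hmem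
  refine ⟨T₀.mkContinuous C fun u => ?_, fun u => rfl⟩
  rw [ShubinSobolev.norm_eq_toReal_eLpNorm, ShubinSobolev.norm_eq_toReal_eLpNorm]
  have := ENNReal.toReal_mono (hfin u).ne (hC u.incl)
  rwa [ENNReal.toReal_mul, ENNReal.coe_toReal] at this

end Schur

end AnisoShubin

end

theorem proposition4p2 (d : ℕ) (σ : ℝ) (hσ : 0 < σ) (m s : ℝ)
    (φ : SchwartzMap (AnisoShubin.Rd d) ℂ) (hφ : φ ≠ 0)
    (a : AnisoShubin.Rd d × AnisoShubin.Rd d → ℂ) (ha : AnisoShubin.IsSymbol m σ a) :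
    -- `a^w(x, D)` is a well-defined operator on tempered distributions,
    (∃! A : TemperedDistribution (AnisoShubin.Rd d) ℂ →L[ℂ] TemperedDistribution (AnisoShubin.Rd d) ℂ,
      AnisoShubin.IsWeylOperator a A) ∧
    -- and it restricts to a continuous operator from `M_{σ,s+m}` to `M_{σ,s}`.
    ∀ A : TemperedDistribution (AnisoShubin.Rd d) ℂ →L[ℂ] TemperedDistribution (AnisoShubin.Rd d) ℂ,
      AnisoShubin.IsWeylOperator a A →
        ∃ T : AnisoShubin.ShubinSobolev σ (s + m) φ →L[ℂ] AnisoShubin.ShubinSobolev σ s φ,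
          ∀ u : AnisoShubin.ShubinSobolev σ (s + m) φ, (T u).incl = A u.incl := by
  obtain ⟨A₀, hA₀, -⟩ := AnisoShubin.exists_isWeylOperator hσ ha hφ
  exact ⟨⟨A₀, hA₀, fun A hA => hA.unique hA₀⟩, fun A hA => hA.exists_restriction hσ ha s hφ⟩
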